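/- **Theorem 1.** Let $s\in(0,1)$, $p\in[1,\infty)$, $n=2$, and let $F:\mathbb{R}\times(\mathbb{R}^n\setminus\{0\})\to[0,\infty)$ satisfy, for all $t,t_1,t_2\in\mathbb{R}$, all $x,x_1,x_2\in\mathbb{R}^n\setminus\{0\}$ and all $i=1,\dots,n$, with constants $c_*,c^*,c_1,c_2,c_3>0$ independent of $t$ and $x$: 1. $F(t,x)=F(-t,x)=F(-t,-x)$; 2. $F(t_1,x)\le F(t_2,x)$ whenever $|t_1|\le|t_2|$; 3. $F(t,x_1)\le F(t,x_2)$ whenever $|x_1|\ge|x_2|$; 4. $F(t,\alpha x)\le\alpha^{-n-sp-1}F(t,x)$ for all $\alpha\in(0,1]$; 5. $c_*\left(\dfrac{|t|^p}{|x|^{n+sp}}-\dfrac{1}{|x|^{n+sp-p}}\right)\le F(t,x)\le c^*\dfrac{|t|^p}{|x|^{n+sp}}$; 6. $F(t,\cdot)\in C^2(\mathbb{R}^n\setminus\{0\})$; 7. $|\partial_{x_i}F(t,x)|\le c_1\,F(t,x)/|x|$; 8. $|\partial_{x_i}^2F(t,x)|\le c_2\,F(t,x)/|x|^2$; 9. $F(\cdot,x)\in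 C^1(\mathbb{R})$ for almost every $x$, and for every $x\neq0$ for which $F(\cdot,x)$ is differentiable on $\mathbb{R}$: 10. $|\partial_tF(t,x)|\le c_3\,|t|^{p-1}/|x|^{n+sp}$, and 11. $\partial_tF(T,x)>\partial_tF(\tau,x)$ whenever $T>\tau$. Let $W:\mathbb{R}\to[0,\infty)$ satisfy $W\in C^2([-1,1])$ and $W(1)=W(-1)=0$. For $R>0$ let $B_R=\{x\in\mathbb{R}^2:|x|<R\}$, let $\mathcal{C}B_R$ be its complement, and for measurable $u:\mathbb{R}^2\to\mathbb{R}$ put $$\mathcal{E}(u,B_R)=\iint_{\mathbb{R}^{4}\setminus(\mathcal{C}B_R)^2}F(u(x)-u(y),x-y)\,dx\,dy+\int_{B_R}W(u)\,dx\in[0,\infty].$$ Let $u:\mathbb{R}^2\to\mathbb{R}$ be continuous with $|u|\le1$, and suppose that for every $R>0$ the function $u$ is a minimizer of $\mathcal{E}(\cdot,B_R)$, that is, $\mathcal{E}(u,B_R)<\infty$ and $\mathcal{E}(u,B_R)\le\mathcal{E}(v,B_R)$ for every measurable $v:\mathbb{R}^2\to\mathbb{R}$ with $v=u$ almost everywhere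 in $\mathcal{C}B_R$. Then $u$ is one-dimensional: there exist $\omega\in S^1$ and $u_0:\mathbb{R}\to\mathbb{R}$ such that $$u(x)=u_0(\omega\cdot x)\qquad\text{for all }x\in\mathbb{R}^2.$$ -/

import Mathlib

open MeasureTheory Set
open scoped ENNReal

/-- The partial derivative of `f` in the `i`-th coordinate direction. -/
noncomputable def partialDeriv {n : ℕ} (i : Fin n) (f : EuclideanSpace ℝ (Fin n) → ℝ)
    (x : EuclideanSpace ℝ (Fin n)) : ℝ :=
  lineDeriv ℝ f x (EuclideanSpace.single i (1 : ℝ))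

/-- The structural assumptions on the interaction `F : ℝ × (ℝⁿ \ {0}) → [0, ∞)`, with parameters
`s` and `p`. Only the values `F t x` with `x ≠ 0` are constrained. -/
structure IsAdmissibleInteraction (n : ℕ) (s p : ℝ)
    (F : ℝ → EuclideanSpace ℝ (Fin n) → ℝ) : Prop where
  /-- `F` takes values in `[0, ∞)` -/
  nonneg : ∀ t x, x ≠ 0 → 0 ≤ F t x
  /-- symmetry -/
  symm : ∀ t x, x ≠ 0 → F t x = F (-t) x ∧ F (-t) x = F (-t) (-x)
  /-- monotonicity in `t` -/
  mono_t : ∀ t₁ t₂ x, x ≠ 0 → |t₁| ≤ |t₂| → F t₁ x ≤ F t₂ x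
  /-- monotonicity in `x` -/
  mono_x : ∀ t x₁ x₂, x₁ ≠ 0 → x₂ ≠ 0 → ‖x₂‖ ≤ ‖x₁‖ → F t x₁ ≤ F t x₂
  /-- scaling in `x` -/
  scaling : ∀ t x (α : ℝ), x ≠ 0 → 0 < α → α ≤ 1 →
    F t (α • x) ≤ α ^ (-(n : ℝ) - s * p - 1) * F t x
  /-- integrability -/
  integrability : ∃ cLow cUp : ℝ, 0 < cLow ∧ 0 < cUp ∧ ∀ t x, x ≠ 0 →
    cLow * (|t| ^ p / ‖x‖ ^ ((n : ℝ) + s * p) - 1 / ‖x‖ ^ ((n : ℝ) + s * p - p)) ≤ F t x ∧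
    F t x ≤ cUp * (|t| ^ p / ‖x‖ ^ ((n : ℝ) + s * p))
  /-- smoothness in `x` -/
  smooth_x : ∀ t, ContDiffOn ℝ 2 (F t) {0}ᶜ
  /-- growth of the first order partial derivatives in `x` -/
  growth_x : ∃ c₁ : ℝ, 0 < c₁ ∧ ∀ t x, x ≠ 0 → ∀ i : Fin n,
    |partialDeriv i (F t) x| ≤ c₁ * (F t x / ‖x‖)
  /-- growth of the pure second order partial derivatives in `x` -/
  growth_xx : ∃ c₂ : ℝ, 0 < c₂ ∧ ∀ t x, x ≠ 0 → ∀ i : Fin n,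
    |partialDeriv i (partialDeriv i (F t)) x| ≤ c₂ * (F t x / ‖x‖ ^ 2)
  /-- smoothness in `t`, for almost every `x` -/
  smooth_t : ∀ᵐ x : EuclideanSpace ℝ (Fin n), ContDiff ℝ 1 (fun t => F t x)
  /-- growth of the derivative in `t` -/
  growth_t : ∃ c₃ : ℝ, 0 < c₃ ∧ ∀ x, x ≠ 0 → Differentiable ℝ (fun t => F t x) →
    ∀ t, |deriv (fun τ => F τ x) t| ≤ c₃ * (|t| ^ (p - 1) / ‖x‖ ^ ((n : ℝ) + s * p))
  /-- strict monotonicity of the derivative in `t` -/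
  strictMono_t : ∀ x, x ≠ 0 → Differentiable ℝ (fun t => F t x) →
    ∀ T τ, τ < T → deriv (fun t => F t x) τ < deriv (fun t => F t x) T

/-- `W : ℝ → [0, ∞)` is a double-well potential: `C²` on `[-1, 1]` and zero at `±1`. -/
structure IsDoubleWell (W : ℝ → ℝ) : Prop where
  nonneg : ∀ t, 0 ≤ W t
  contDiffOn : ContDiffOn ℝ 2 W (Icc (-1) 1)
  map_one : W 1 = 0
  map_neg_one : W (-1) = 0

/-- The kinetic part: the integral of `F (u x - u y, x - y)` over `ℝ²ⁿ \ (Ωᶜ × Ωᶜ)`. The integrand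
is nonnegative off the (null) diagonal, so the integral is taken in `[0, ∞]`. -/
noncomputable def kineticEnergy {n : ℕ} (F : ℝ → EuclideanSpace ℝ (Fin n) → ℝ)
    (u : EuclideanSpace ℝ (Fin n) → ℝ) (Ω : Set (EuclideanSpace ℝ (Fin n))) : ℝ≥0∞ :=
  ∫⁻ z : EuclideanSpace ℝ (Fin n) × EuclideanSpace ℝ (Fin n) in (Ωᶜ ×ˢ Ωᶜ)ᶜ,
    ENNReal.ofReal (F (u z.1 - u z.2) (z.1 - z.2))

/-- The nonlocal energy `𝓔(u, Ω)`: kinetic part plus potential part. -/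
noncomputable def nonlocalEnergy {n : ℕ} (F : ℝ → EuclideanSpace ℝ (Fin n) → ℝ) (W : ℝ → ℝ)
    (u : EuclideanSpace ℝ (Fin n) → ℝ) (Ω : Set (EuclideanSpace ℝ (Fin n))) : ℝ≥0∞ :=
  kineticEnergy F u Ω + ∫⁻ x in Ω, ENNReal.ofReal (W (u x))

/-- `u` is a minimizer of the energy in `Ω`: it is measurable, has finite energy in `Ω`, and has
least energy among all measurable functions that agree with it a.e. outside `Ω`. -/
structure IsEnergyMinimizer {n : ℕ} (F : ℝ → EuclideanSpace ℝ (Fin n) → ℝ) (W : ℝ → ℝ)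
    (u : EuclideanSpace ℝ (Fin n) → ℝ) (Ω : Set (EuclideanSpace ℝ (Fin n))) : Prop where
  measurable : Measurable u
  energy_lt_top : nonlocalEnergy F W u Ω < ⊤
  le_energy : ∀ v : EuclideanSpace ℝ (Fin n) → ℝ, Measurable v →
    (∀ᵐ x, x ∈ Ωᶜ → v x = u x) → nonlocalEnergy F W u Ω ≤ nonlocalEnergy F W v Ω

/-! The translates of `u` turn out to be pairwise ordered: for every `h`, either `u ≤ u (· + h)` or
`u (· + h) ≤ u`. Then the set `A` of `h` with `u ≤ u (· + h)` is a closed cone and the plane is `A ∪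
-A`. Since the unit circle is connected, some unit vector `e` lies in both `A` and `-A`, so `u` is
invariant along `e` (`exists_one_dimensional_of_translates_ordered`).

To order `u` and a translate, let `v = u ∘ Φ⁻¹` with `Φ x = x + g x • h` and `g` a cutoff at scale
`R`: `v` is the translate near the origin and equals `u` outside `B_R`. For the opposite deformation
`Ψ`, built from `-h`, the first order terms cancel or have a favourable sign. Hence the energies of
`u ∘ Φ⁻¹` and `u ∘ Ψ⁻¹` add up to at most `2 𝓔(u) + η`, where `η` is `O(R⁻²)` times the kinetic
energy of `u` in `B_{R/2}` (`exists_deformation_bound`). Minimality against `u ∘ Ψ⁻¹` gives `𝓔(v) ≤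
𝓔(u) + η`.

Convexity of `F` in `t` makes the energy submodular: replacing `u, v` by their minimum and maximum
lowers the total by exactly the integrated rearrangement gain. Both are competitors for `u`, so this
gain is at most `η`. Comparison with a radial barrier shows that the kinetic energy is `o(R²)` along
a sequence of radii (`tendsto_kineticEnergy_div`); in dimension two this suffices for `η → 0`. The
gain of `u` and its translate therefore vanishes on every ball, and strict convexity with continuity
forces the order (`le_or_le_of_gain_eq_zero`). -/

/-- The Euclidean plane. -/
abbrev Plane := EuclideanSpace ℝ (Fin 2)

/-! ### Second variation and convexity of the interaction -/

/-- A first order Taylor estimate on `[r / 2, 2 r]`, with the remainder controlled by a bound on the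
second derivative. -/
lemma taylor_le_of_abs_deriv_deriv_le {f : ℝ → ℝ} {r M ρ : ℝ} (hr : 0 < r)
    (hf : ContDiffOn ℝ 2 f (Ioi 0))
    (hM : ∀ x ∈ Icc (r / 2) (2 * r), |deriv (deriv f) x| ≤ M) (hρ : ρ ∈ Icc (r / 2) (2 * r)) :
    f ρ ≤ f r + deriv f r * (ρ - r) + M * (ρ - r) ^ 2 := by
  have hrI : r ∈ Icc (r / 2) (2 * r) := ⟨by linarith, by linarith⟩
  have hpos : ∀ x ∈ Icc (r / 2) (2 * r), 0 < x := fun x hx => lt_of_lt_of_le (by linarith) hx.1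
  have hd1 : ∀ x, 0 < x → DifferentiableAt ℝ f x := fun x hx =>
    (hf.differentiableOn (by norm_num)).differentiableAt (Ioi_mem_nhds hx)
  have hd2 : ∀ x, 0 < x → DifferentiableAt ℝ (deriv f) x := fun x hx =>
    (((hf.deriv_of_isOpen isOpen_Ioi (m := 1) (by norm_num))).differentiableOn
      (by norm_num)).differentiableAt (Ioi_mem_nhds hx)
  have key1 : ∀ x ∈ Icc (r / 2) (2 * r), |deriv f x - deriv f r| ≤ M * |x - r| := by
    intro x hx
    have := (convex_Icc (r / 2) (2 * r)).norm_image_sub_le_of_norm_deriv_le (f := deriv f)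
      (fun y hy => hd2 y (hpos y hy)) (fun y hy => by simpa using hM y hy) hrI hx
    simpa using this
  have hM0 : 0 ≤ M := (abs_nonneg _).trans (hM r hrI)
  have hsub : uIcc r ρ ⊆ Icc (r / 2) (2 * r) := by
    rw [← segment_eq_uIcc]; exact (convex_Icc _ _).segment_subset hrI hρ
  have key2 := (convex_uIcc r ρ).norm_image_sub_le_of_norm_deriv_le
    (f := fun x => f x - deriv f r * x) (C := M * |ρ - r|)
    (fun y hy => (hd1 y (hpos y (hsub hy))).sub (by fun_prop))
    (fun y hy => by
      have h1 : deriv (fun x => f x - deriv f r * x) y = deriv f y - deriv f r := by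
        rw [deriv_fun_sub (hd1 y (hpos y (hsub hy))) (by fun_prop)]
        simp
      rw [h1, Real.norm_eq_abs]
      refine (key1 y (hsub hy)).trans (mul_le_mul_of_nonneg_left ?_ hM0)
      exact abs_sub_left_of_mem_uIcc hy)
    left_mem_uIcc right_mem_uIcc
  rw [Real.norm_eq_abs, Real.norm_eq_abs, mul_assoc, abs_mul_abs_self] at key2
  nlinarith [(abs_le.1 key2).2]

/-- Second variation estimate for a nonincreasing function on `(0, ∞)` with scale invariant
derivative bounds. -/
lemma radial_second_variation {f : ℝ → ℝ} {c₁ c₂ K : ℝ} (hc₁ : 0 < c₁) (hc₂ : 0 < c₂) (hK : 0 < K)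
    (hf : ContDiffOn ℝ 2 f (Ioi 0)) (hf0 : ∀ r, 0 < r → 0 ≤ f r) (hanti : AntitoneOn f (Ioi 0))
    (h1 : ∀ r, 0 < r → |deriv f r| ≤ c₁ * (f r / r))
    (h2 : ∀ r, 0 < r → |deriv (deriv f) r| ≤ c₂ * (f r / r ^ 2))
    (hhalf : ∀ r, 0 < r → f (r / 2) ≤ K * f r)
    {r ε ρ₁ ρ₂ a b : ℝ} (hr : 0 < r) (hε : ε ≤ 1 / 2) (hρ₁ : |ρ₁ - r| ≤ ε * r)
    (hρ₂ : |ρ₂ - r| ≤ ε * r) (hsum : 2 * r ≤ ρ₁ + ρ₂) (ha : |a| ≤ ε) (hb : |b| ≤ ε) :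
    f ρ₁ * ((1 + a) * (1 + b)) + f ρ₂ * ((1 - a) * (1 - b)) ≤
      (2 + (8 * c₂ + 2 + 8 * c₁) * K * ε ^ 2) * f r := by
  have hε0 : 0 ≤ ε := (abs_nonneg a).trans ha
  have hpos : ∀ x ∈ Icc (r / 2) (2 * r), 0 < x := fun x hx => lt_of_lt_of_le (by linarith) hx.1
  have hd1 : ∀ x, 0 < x → DifferentiableAt ℝ f x := fun x hx =>
    (hf.differentiableOn (by norm_num)).differentiableAt (Ioi_mem_nhds hx)
  have hI : ∀ ρ, |ρ - r| ≤ ε * r → ρ ∈ Icc (r / 2) (2 * r) := by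
    intro ρ hρ
    have := abs_le.1 hρ
    constructor <;> nlinarith
  have hfr := hf0 r hr
  have hle : ∀ x ∈ Icc (r / 2) (2 * r), f x ≤ K * f r := fun x hx =>
    (hanti (show r / 2 ∈ Ioi (0 : ℝ) from half_pos hr) (hpos x hx) hx.1).trans (hhalf r hr)
  have hb1 : ∀ x ∈ Icc (r / 2) (2 * r), |deriv f x| ≤ 2 * c₁ * K * (f r / r) := by
    intro x hx
    have hx0 := hpos x hx
    refine (h1 x hx0).trans ?_
    have : f x / x ≤ K * f r / (r / 2) :=
      div_le_div₀ (by positivity) (hle x hx) (by positivity) hx.1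
    calc c₁ * (f x / x) ≤ c₁ * (K * f r / (r / 2)) := by gcongr
      _ = _ := by field_simp
  have hb2 : ∀ x ∈ Icc (r / 2) (2 * r), |deriv (deriv f) x| ≤ 4 * c₂ * K * (f r / r ^ 2) := by
    intro x hx
    have hx0 := hpos x hx
    refine (h2 x hx0).trans ?_
    have : f x / x ^ 2 ≤ K * f r / (r / 2) ^ 2 :=
      div_le_div₀ (by positivity) (hle x hx) (by positivity)
        (pow_le_pow_left₀ (by positivity) hx.1 2)
    calc c₂ * (f x / x ^ 2) ≤ c₂ * (K * f r / (r / 2) ^ 2) := by gcongr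
      _ = _ := by field_simp; ring
  -- The first order Taylor terms add up to `f' r * (ρ₁ + ρ₂ - 2 r)`. They need not cancel, but
  -- monotonicity and `hsum` make the sum nonpositive.
  have hder : deriv f r ≤ 0 := by
    rw [← derivWithin_of_isOpen isOpen_Ioi (show r ∈ Ioi (0 : ℝ) from hr)]
    exact hanti.derivWithin_nonpos
  have t1 := taylor_le_of_abs_deriv_deriv_le hr hf hb2 (hI _ hρ₁)
  have t2 := taylor_le_of_abs_deriv_deriv_le hr hf hb2 (hI _ hρ₂)
  have sq : ∀ ρ, |ρ - r| ≤ ε * r →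
      4 * c₂ * K * (f r / r ^ 2) * (ρ - r) ^ 2 ≤ 4 * c₂ * K * ε ^ 2 * f r := by
    intro ρ hρ
    have : (ρ - r) ^ 2 ≤ (ε * r) ^ 2 := sq_le_sq' (abs_le.1 hρ).1 (abs_le.1 hρ).2
    calc 4 * c₂ * K * (f r / r ^ 2) * (ρ - r) ^ 2
        ≤ 4 * c₂ * K * (f r / r ^ 2) * (ε * r) ^ 2 := by gcongr
      _ = _ := by field_simp
  have hS : f ρ₁ + f ρ₂ ≤ 2 * f r + 8 * c₂ * K * ε ^ 2 * f r := by
    have := sq _ hρ₁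
    have := sq _ hρ₂
    nlinarith
  have hD : |f ρ₁ - f ρ₂| ≤ 4 * c₁ * K * ε * f r := by
    have := (convex_Icc (r / 2) (2 * r)).norm_image_sub_le_of_norm_deriv_le (f := f)
      (fun y hy => hd1 y (hpos y hy)) (fun y hy => by simpa using hb1 y hy) (hI _ hρ₂) (hI _ hρ₁)
    rw [Real.norm_eq_abs, Real.norm_eq_abs] at this
    refine this.trans ?_
    have h3 : |ρ₁ - ρ₂| ≤ 2 * (ε * r) := by
      rw [abs_le] at *
      constructor <;> linarith [hρ₁.1, hρ₁.2, hρ₂.1, hρ₂.2]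
    calc 2 * c₁ * K * (f r / r) * |ρ₁ - ρ₂| ≤ 2 * c₁ * K * (f r / r) * (2 * (ε * r)) := by gcongr
      _ = _ := by field_simp; ring
  -- The left side is `(f ρ₁ + f ρ₂) * (1 + a * b) + (f ρ₁ - f ρ₂) * (a + b)`. The constants `8 *
  -- c₂`, `2` and `8 * c₁` come from `hS`, `hS'` and `hD'` respectively.
  have hab : a * b ≤ ε ^ 2 := by
    refine (le_abs_self _).trans ?_
    rw [abs_mul, pow_two]
    exact mul_le_mul ha hb (abs_nonneg _) hε0
  have hD' : (f ρ₁ - f ρ₂) * (a + b) ≤ 4 * c₁ * K * ε * f r * (2 * ε) := by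
    refine (le_abs_self _).trans ?_
    rw [abs_mul]
    refine mul_le_mul hD ((abs_add_le a b).trans (by linarith)) (abs_nonneg _) (by positivity)
  have hS' : (f ρ₁ + f ρ₂) * (a * b) ≤ (K * f r + K * f r) * ε ^ 2 := by
    have p1 := hf0 _ (hpos _ (hI _ hρ₁))
    have p2 := hf0 _ (hpos _ (hI _ hρ₂))
    calc (f ρ₁ + f ρ₂) * (a * b) ≤ (f ρ₁ + f ρ₂) * ε ^ 2 := by gcongr
      _ ≤ _ := by gcongr <;> [exact hle _ (hI _ hρ₁); exact hle _ (hI _ hρ₂)]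
  nlinarith

namespace IsAdmissibleInteraction

variable {s p : ℝ} {F : ℝ → Plane → ℝ}

lemma radial (hF : IsAdmissibleInteraction 2 s p F) (t : ℝ) {x y : Plane} (hx : x ≠ 0) (hy : y ≠ 0)
    (hxy : ‖x‖ = ‖y‖) : F t x = F t y :=
  le_antisymm (hF.mono_x t x y hx hy hxy.ge) (hF.mono_x t y x hy hx hxy.le)

/-- Since `F t` is radial, its coordinate derivatives along one axis are the derivatives of its
profile, and `radial_second_variation` applies with radii `‖z ± d‖`. In the application `d` is the
relative displacement of two points under a deformation, and `1 ± a`, `1 ± b` are the Jacobians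
there. -/
lemma second_variation (hF : IsAdmissibleInteraction 2 s p F) :
    ∃ C : ℝ, 0 ≤ C ∧ ∀ (t ε a b : ℝ) (z d : Plane), z ≠ 0 → ε ≤ 1 / 2 → ‖d‖ ≤ ε * ‖z‖ →
      |a| ≤ ε → |b| ≤ ε →
      F t (z + d) * ((1 + a) * (1 + b)) + F t (z - d) * ((1 - a) * (1 - b)) ≤
        (2 + C * ε ^ 2) * F t z := by
  obtain ⟨c₁, hc₁, h1⟩ := hF.growth_x
  obtain ⟨c₂, hc₂, h2⟩ := hF.growth_xx
  -- The factor in the scaling assumption at `α = 1 / 2`, which bounds `f (r / 2)` by `f r`.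
  set K : ℝ := (1 / 2 : ℝ) ^ (-((2 : ℕ) : ℝ) - s * p - 1) with hK
  have hK0 : 0 < K := by positivity
  refine ⟨(8 * c₂ + 2 + 8 * c₁) * K, by positivity, ?_⟩
  intro t ε a b z d hz hε hd ha hb
  set e : Plane := EuclideanSpace.single 0 (1 : ℝ) with he
  have hen : ‖e‖ = 1 := by simp [he]
  have he0 : e ≠ 0 := by rw [← norm_ne_zero_iff, hen]; norm_num
  set f : ℝ → ℝ := fun r => F t (r • e) with hfdef
  have hne : ∀ r : ℝ, 0 < r → r • e ≠ 0 := fun r hr => smul_ne_zero hr.ne' he0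
  have hnorm : ∀ r : ℝ, 0 < r → ‖r • e‖ = r := fun r hr => by
    rw [norm_smul, hen, mul_one, Real.norm_of_nonneg hr.le]
  have hprof : ∀ x : Plane, x ≠ 0 → F t x = f ‖x‖ := fun x hx =>
    hF.radial t hx (hne _ (norm_pos_iff.2 hx)) (hnorm _ (norm_pos_iff.2 hx)).symm
  have hp1 : ∀ r : ℝ, partialDeriv 0 (F t) (r • e) = deriv f r := by
    intro r
    have : (fun τ : ℝ => F t (r • e + τ • e)) = fun τ => f (r + τ) := by
      ext τ; simp only [hfdef, add_smul]
    rw [partialDeriv, lineDeriv, ← he, this, deriv_comp_const_add, add_zero]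
  have hp2 : ∀ r : ℝ, partialDeriv 0 (partialDeriv 0 (F t)) (r • e) = deriv (deriv f) r := by
    intro r
    have : (fun τ : ℝ => partialDeriv 0 (F t) (r • e + τ • e)) = fun τ => deriv f (r + τ) := by
      ext τ; rw [← add_smul, hp1]
    rw [partialDeriv, lineDeriv, ← he, this, deriv_comp_const_add, add_zero]
  have hz0 : 0 < ‖z‖ := norm_pos_iff.2 hz
  have hnd : ‖d‖ ≤ ‖z‖ / 2 := hd.trans (by nlinarith)
  have hpl : z + d ≠ 0 := by
    intro h
    have : ‖z‖ = ‖d‖ := by rw [eq_neg_of_add_eq_zero_left h, norm_neg]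
    linarith
  have hmi : z - d ≠ 0 := by
    intro h
    have : ‖z‖ = ‖d‖ := by rw [sub_eq_zero.1 h]
    linarith
  rw [hprof _ hpl, hprof _ hmi, hprof z hz]
  refine radial_second_variation hc₁ hc₂ hK0 ?_ ?_ ?_ ?_ ?_ ?_ hz0 hε ?_ ?_ ?_ ha hb
  · exact (hF.smooth_x t).comp (by fun_prop) fun r hr => hne r hr
  · exact fun r hr => hF.nonneg t _ (hne r hr)
  · intro r hr r' hr' hrr
    exact hF.mono_x t _ _ (hne r' hr') (hne r hr) (by rwa [hnorm r hr, hnorm r' hr'])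
  · intro r hr
    have := h1 t _ (hne r hr) 0
    rwa [hp1, hnorm r hr] at this
  · intro r hr
    have := h2 t _ (hne r hr) 0
    rwa [hp2, hnorm r hr] at this
  · intro r hr
    have := hF.scaling t _ (1 / 2) (hne r hr) (by norm_num) (by norm_num)
    rwa [smul_smul, one_div_mul_eq_div] at this
  · refine (abs_norm_sub_norm_le _ _).trans ?_
    simpa using hd
  · refine (abs_norm_sub_norm_le _ _).trans ?_
    simpa using hd
  · calc 2 * ‖z‖ = ‖(z + d) + (z - d)‖ := by
          rw [show (z + d) + (z - d) = (2 : ℝ) • z by rw [two_smul]; abel, norm_smul]; norm_num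
      _ ≤ _ := norm_add_le _ _

lemma ae_strictConvexOn (hF : IsAdmissibleInteraction 2 s p F) :
    ∀ᵐ x : Plane, StrictConvexOn ℝ univ fun t => F t x := by
  have h0 : ∀ᵐ x : Plane, x ≠ 0 := by simp [ae_iff]
  filter_upwards [hF.smooth_t, h0] with x hx hx0
  exact StrictMono.strictConvexOn_univ_of_deriv hx.continuous fun τ T h =>
    hF.strictMono_t x hx0 (hx.differentiable (by norm_num)) T τ h

/-- A set of full measure is dense, and the convexity inequality passes to limits in `x` by
continuity of `F t`. Strictness may be lost, so it is kept only almost everywhere. -/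
lemma convexOn (hF : IsAdmissibleInteraction 2 s p F) {x : Plane} (hx : x ≠ 0) :
    ConvexOn ℝ univ fun t => F t x := by
  have hd : Dense {y : Plane | StrictConvexOn ℝ univ fun t => F t y} :=
    Measure.dense_of_ae hF.ae_strictConvexOn
  have hc : ∀ t, ContinuousAt (F t) x := fun t =>
    (hF.smooth_x t).continuousOn.continuousAt (isOpen_compl_singleton.mem_nhds hx)
  refine ⟨convex_univ, fun t₁ _ t₂ _ a b ha hb hab => ?_⟩
  have hfreq := mem_closure_iff_frequently.1 (hd x)
  have hlim : ContinuousAt (fun y => a • F t₁ y + b • F t₂ y - F (a • t₁ + b • t₂) y) x :=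
    (((hc t₁).const_smul a).add ((hc t₂).const_smul b)).sub (hc _)
  have := ge_of_tendsto_of_frequently hlim (hfreq.mono fun y
    (hy : StrictConvexOn ℝ univ fun t => F t y) =>
    sub_nonneg.2 (hy.convexOn.2 (mem_univ t₁) (mem_univ t₂) ha hb hab))
  simpa using this

end IsAdmissibleInteraction

/-! ### Reduction to a kernel controlled at the origin -/

/-- The properties of the interaction kernel that the symmetry argument uses. -/
structure IsConvexKernel (s p : ℝ) (K : ℝ → Plane → ℝ) : Prop where
  zero : ∀ t, K t 0 = 0
  nonneg : ∀ t x, 0 ≤ K t x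
  measurable : Measurable (Function.uncurry K)
  convexOn : ∀ x, ConvexOn ℝ univ fun t => K t x
  ae_strictConvexOn : ∀ᵐ x, StrictConvexOn ℝ univ fun t => K t x
  upper : ∃ c : ℝ, 0 < c ∧ ∀ t x, K t x ≤ c * (|t| ^ p / ‖x‖ ^ (2 + s * p))
  second_variation : ∃ C : ℝ, 0 ≤ C ∧ ∀ (t ε a b : ℝ) (z d : Plane), ε ≤ 1 / 2 → ‖d‖ ≤ ε * ‖z‖ →
      |a| ≤ ε → |b| ≤ ε →
      K t (z + d) * ((1 + a) * (1 + b)) + K t (z - d) * ((1 - a) * (1 - b)) ≤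
        (2 + C * ε ^ 2) * K t z

open Classical in
/-- The interaction `F`, set to zero at the singularity. -/
noncomputable def zeroAtOrigin (F : ℝ → Plane → ℝ) (t : ℝ) (x : Plane) : ℝ :=
  if x = 0 then 0 else F t x

/-- Nothing is known about `F t 0`. With the value `0` there, every property holds without excluding
the origin, and energies are unchanged because the diagonal is null. -/
lemma IsAdmissibleInteraction.isConvexKernel_zeroAtOrigin {s p : ℝ} {F : ℝ → Plane → ℝ}
    (hF : IsAdmissibleInteraction 2 s p F) : IsConvexKernel s p (zeroAtOrigin F) := by
  have hne : ∀ {t x}, x ≠ 0 → zeroAtOrigin F t x = F t x := fun hx => if_neg hx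
  have h0 : ∀ t, zeroAtOrigin F t 0 = 0 := fun t => if_pos rfl
  have hconv : ∀ x, ConvexOn ℝ univ fun t => zeroAtOrigin F t x := by
    intro x
    rcases eq_or_ne x 0 with rfl | hx
    · simpa only [h0] using convexOn_const (0 : ℝ) convex_univ
    · simpa only [hne hx] using hF.convexOn hx
  refine ⟨h0, fun t x => ?_, ?_, hconv, ?_, ?_, ?_⟩
  · rcases eq_or_ne x 0 with rfl | hx
    · rw [h0]
    · rw [hne hx]; exact hF.nonneg t x hx
  · have hmeas : ∀ t, Measurable (zeroAtOrigin F t) := by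
      intro t
      have h1 : ContinuousOn (F t) {(0 : Plane)}ᶜ := (hF.smooth_x t).continuousOn
      have h2 := h1.measurable_piecewise (continuousOn_const (c := (0 : ℝ)) (s := {(0 : Plane)}ᶜᶜ))
        (measurableSet_singleton (0 : Plane)).compl
      convert h2 using 1
      ext x
      by_cases hx : x = 0 <;> simp [zeroAtOrigin, hx]
    -- Carathéodory: finite convex functions on the line are continuous, and continuity in `t` with
    -- measurability in `x` gives joint measurability.
    have := measurable_uncurry_of_continuous_of_measurable (u := fun t x => zeroAtOrigin F t x)
      (fun x => continuousOn_univ.1 ((hconv x).continuousOn isOpen_univ)) hmeas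
    exact this
  · have h1 : ∀ᵐ x : Plane, x ≠ 0 := by simp [ae_iff]
    filter_upwards [hF.ae_strictConvexOn, h1] with x hx hx0
    simpa only [hne hx0] using hx
  · obtain ⟨c, C, hc, hC, h⟩ := hF.integrability
    refine ⟨C, hC, fun t x => ?_⟩
    rcases eq_or_ne x 0 with rfl | hx
    · rw [h0]; positivity
    · rw [hne hx]; simpa using (h t x hx).2
  · obtain ⟨C, hC, h⟩ := hF.second_variation
    refine ⟨C, hC, fun t ε a b z d hε hd ha hb => ?_⟩
    rcases eq_or_ne z 0 with rfl | hz
    · have : d = 0 := by simpa using hd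
      simp [this, h0]
    · have hz0 : 0 < ‖z‖ := norm_pos_iff.2 hz
      have hnd : ‖d‖ ≤ ‖z‖ / 2 := hd.trans (by nlinarith)
      have hpl : z + d ≠ 0 := by
        intro h
        have : ‖z‖ = ‖d‖ := by rw [eq_neg_of_add_eq_zero_left h, norm_neg]
        linarith
      have hmi : z - d ≠ 0 := by
        intro h
        have : ‖z‖ = ‖d‖ := by rw [sub_eq_zero.1 h]
        linarith
      rw [hne hpl, hne hmi, hne hz]
      exact h t ε a b z d hz hε hd ha hb

lemma ae_sub_ne_zero : ∀ᵐ z : Plane × Plane, z.1 - z.2 ≠ 0 := by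
  have h1 : ∀ᵐ x : Plane, x ≠ 0 := by simp [ae_iff]
  exact (quasiMeasurePreserving_sub_of_right_invariant volume volume).ae h1

lemma kineticEnergy_zeroAtOrigin (F : ℝ → Plane → ℝ) (u : Plane → ℝ) (Ω : Set Plane) :
    kineticEnergy (zeroAtOrigin F) u Ω = kineticEnergy F u Ω := by
  refine lintegral_congr_ae (ae_restrict_of_ae ?_)
  filter_upwards [ae_sub_ne_zero] with z hz
  rw [zeroAtOrigin, if_neg hz]

lemma nonlocalEnergy_zeroAtOrigin (F : ℝ → Plane → ℝ) (W : ℝ → ℝ) (u : Plane → ℝ) (Ω : Set Plane) :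
    nonlocalEnergy (zeroAtOrigin F) W u Ω = nonlocalEnergy F W u Ω := by
  rw [nonlocalEnergy, nonlocalEnergy, kineticEnergy_zeroAtOrigin]

lemma IsEnergyMinimizer.zeroAtOrigin {F : ℝ → Plane → ℝ} {W : ℝ → ℝ} {u : Plane → ℝ} {Ω : Set Plane}
    (h : IsEnergyMinimizer F W u Ω) : IsEnergyMinimizer (zeroAtOrigin F) W u Ω where
  measurable := h.measurable
  energy_lt_top := by rw [nonlocalEnergy_zeroAtOrigin]; exact h.energy_lt_top
  le_energy v hv hvu := by
    rw [nonlocalEnergy_zeroAtOrigin, nonlocalEnergy_zeroAtOrigin]; exact h.le_energy v hv hvu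

/-! ### Submodularity -/

/-- The points `y` and `z` are convex combinations of `x` and `w` with interchanged weights, so the
two convexity inequalities add up to the claim. -/
lemma ConvexOn.add_le_add_of_mem_Icc {g : ℝ → ℝ} (hg : ConvexOn ℝ univ g) {x y z w : ℝ}
    (hy : y ∈ Icc x w) (hsum : y + z = x + w) : g y + g z ≤ g x + g w := by
  rcases (hy.1.trans hy.2).eq_or_lt with h | h
  · obtain rfl : y = x := le_antisymm (by linarith [hy.2]) hy.1
    obtain rfl : z = w := by linarith
    rfl
  · have hd : 0 < w - x := sub_pos.2 h
    have hg' := hg.2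
    have h1 := hg' (mem_univ x) (mem_univ w) (a := (w - y) / (w - x)) (b := (y - x) / (w - x))
      (div_nonneg (by linarith [hy.2]) hd.le) (div_nonneg (by linarith [hy.1]) hd.le)
      (by field_simp; ring)
    have h2 := hg' (mem_univ x) (mem_univ w) (a := (y - x) / (w - x)) (b := (w - y) / (w - x))
      (div_nonneg (by linarith [hy.1]) hd.le) (div_nonneg (by linarith [hy.2]) hd.le)
      (by field_simp; ring)
    have e1 : ((w - y) / (w - x)) • x + ((y - x) / (w - x)) • w = y := by
      simp only [smul_eq_mul]; field_simp; ring
    have e2 : ((y - x) / (w - x)) • x + ((w - y) / (w - x)) • w = z := by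
      obtain rfl : z = x + w - y := by linarith
      simp only [smul_eq_mul]; field_simp; ring
    have e3 : (w - y) / (w - x) + (y - x) / (w - x) = 1 := by field_simp; ring
    rw [e1] at h1
    rw [e2] at h2
    simp only [smul_eq_mul] at h1 h2
    calc g y + g z ≤ ((w - y) / (w - x) + (y - x) / (w - x)) * (g x + g w) := by linarith
      _ = _ := by rw [e3, one_mul]

lemma StrictConvexOn.add_lt_add_of_mem_Ioo {g : ℝ → ℝ} (hg : StrictConvexOn ℝ univ g) {x y z w : ℝ}
    (hy : y ∈ Ioo x w) (hsum : y + z = x + w) : g y + g z < g x + g w := by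
  have h : x < w := hy.1.trans hy.2
  have hd : 0 < w - x := sub_pos.2 h
  have hg' := hg.2
  have h1 := hg' (mem_univ x) (mem_univ w) h.ne (a := (w - y) / (w - x)) (b := (y - x) / (w - x))
    (div_pos (by linarith [hy.2]) hd) (div_pos (by linarith [hy.1]) hd)
    (by field_simp; ring)
  have h2 := hg' (mem_univ x) (mem_univ w) h.ne (a := (y - x) / (w - x)) (b := (w - y) / (w - x))
    (div_pos (by linarith [hy.1]) hd) (div_pos (by linarith [hy.2]) hd)
    (by field_simp; ring)
  have e1 : ((w - y) / (w - x)) • x + ((y - x) / (w - x)) • w = y := by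
    simp only [smul_eq_mul]; field_simp; ring
  have e2 : ((y - x) / (w - x)) • x + ((w - y) / (w - x)) • w = z := by
    obtain rfl : z = x + w - y := by linarith
    simp only [smul_eq_mul]; field_simp; ring
  have e3 : (w - y) / (w - x) + (y - x) / (w - x) = 1 := by field_simp; ring
  rw [e1] at h1
  rw [e2] at h2
  simp only [smul_eq_mul] at h1 h2
  calc g y + g z < ((w - y) / (w - x) + (y - x) / (w - x)) * (g x + g w) := by linarith
    _ = _ := by rw [e3, one_mul]

/-- Only a crossing, `a ≤ a'` with `b' ≤ b` or the reverse, changes anything. The new differences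
then lie between the old ones and have the same sum. -/
lemma ConvexOn.min_sub_min_add_max_sub_max_le {g : ℝ → ℝ} (hg : ConvexOn ℝ univ g)
    (a b a' b' : ℝ) :
    g (min a a' - min b b') + g (max a a' - max b b') ≤ g (a - b) + g (a' - b') := by
  rcases le_total a a' with h | h <;> rcases le_total b b' with h' | h' <;>
    simp only [min_eq_left, min_eq_right, max_eq_left, max_eq_right, h, h']
  · rfl
  · exact hg.add_le_add_of_mem_Icc ⟨by linarith, by linarith⟩ (by ring)
  · rw [add_comm (g (a - b))]
    exact hg.add_le_add_of_mem_Icc ⟨by linarith, by linarith⟩ (by ring)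
  · rw [add_comm]

/-- The decrease of the interaction density when `u`, `v` are replaced by their minimum and
maximum. -/
noncomputable def rearrangementGain (K : ℝ → Plane → ℝ) (u v : Plane → ℝ) (z : Plane × Plane) :
    ℝ≥0∞ :=
  ENNReal.ofReal (K (u z.1 - u z.2) (z.1 - z.2) + K (v z.1 - v z.2) (z.1 - z.2) -
    (K (min (u z.1) (v z.1) - min (u z.2) (v z.2)) (z.1 - z.2) +
      K (max (u z.1) (v z.1) - max (u z.2) (v z.2)) (z.1 - z.2)))

namespace IsConvexKernel

variable {s p : ℝ} {K : ℝ → Plane → ℝ} {u v : Plane → ℝ}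

lemma measurable_interaction (hK : IsConvexKernel s p K) (hu : Measurable u) :
    Measurable fun z : Plane × Plane => K (u z.1 - u z.2) (z.1 - z.2) :=
  hK.measurable.comp (by fun_prop :
    Measurable fun z : Plane × Plane => (u z.1 - u z.2, z.1 - z.2))

lemma measurable_ofReal_interaction (hK : IsConvexKernel s p K) (hu : Measurable u) :
    Measurable fun z : Plane × Plane => ENNReal.ofReal (K (u z.1 - u z.2) (z.1 - z.2)) :=
  (hK.measurable_interaction hu).ennreal_ofReal

lemma measurable_rearrangementGain (hK : IsConvexKernel s p K) (hu : Measurable u)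
    (hv : Measurable v) : Measurable (rearrangementGain K u v) :=
  (((hK.measurable_interaction hu).add (hK.measurable_interaction hv)).sub
    ((hK.measurable_interaction (hu.min hv)).add
      (hK.measurable_interaction (hu.max hv)))).ennreal_ofReal

/-- A pointwise identity, with the gain added on the left so that it holds in `[0, ∞]` without
subtracting infinite energies. -/
lemma kineticEnergy_min_add_max_add_gain (hK : IsConvexKernel s p K) (hu : Measurable u)
    (hv : Measurable v) (Ω : Set Plane) :
    kineticEnergy K (fun x => min (u x) (v x)) Ω + kineticEnergy K (fun x => max (u x) (v x)) Ω +
      ∫⁻ z in (Ωᶜ ×ˢ Ωᶜ)ᶜ, rearrangementGain K u v z = kineticEnergy K u Ω + kineticEnergy K v Ω := by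
  have m1 := hK.measurable_ofReal_interaction (hu.min hv)
  have m2 := hK.measurable_ofReal_interaction (hu.max hv)
  rw [kineticEnergy, kineticEnergy, kineticEnergy, kineticEnergy, ← lintegral_add_left m1,
    ← lintegral_add_left (show Measurable fun z : Plane × Plane => _ + _ from m1.add m2),
    ← lintegral_add_left (hK.measurable_ofReal_interaction hu)]
  refine lintegral_congr fun z => ?_
  have := (hK.convexOn (z.1 - z.2)).min_sub_min_add_max_sub_max_le (u z.1) (u z.2) (v z.1) (v z.2)
  rw [rearrangementGain, ← ENNReal.ofReal_add (hK.nonneg _ _) (hK.nonneg _ _),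
    ← ENNReal.ofReal_add (hK.nonneg _ _) (hK.nonneg _ _),
    ← ENNReal.ofReal_add (add_nonneg (hK.nonneg _ _) (hK.nonneg _ _)) (sub_nonneg.2 this)]
  congr 1
  ring

end IsConvexKernel

/-- At a genuine crossing the new differences are strictly inside the interval of the old ones, so
strict convexity gives a strict gain. -/
lemma rearrangementGain_pos {K : ℝ → Plane → ℝ} {u v : Plane → ℝ} {z : Plane × Plane}
    (hz : StrictConvexOn ℝ univ fun t => K t (z.1 - z.2)) (h1 : u z.1 < v z.1)
    (h2 : v z.2 < u z.2) : 0 < rearrangementGain K u v z := by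
  rw [rearrangementGain, ENNReal.ofReal_pos, min_eq_left h1.le, min_eq_right h2.le,
    max_eq_right h1.le, max_eq_left h2.le, sub_pos]
  exact hz.add_lt_add_of_mem_Ioo ⟨by linarith, by linarith⟩ (by ring)

/-- Continuous functions with zero rearrangement gain are ordered. -/
lemma IsConvexKernel.le_or_le_of_gain_eq_zero {s p : ℝ} {K : ℝ → Plane → ℝ} {u v : Plane → ℝ}
    (hK : IsConvexKernel s p K) (hu : Continuous u) (hv : Continuous v)
    (h : ∀ r : ℝ, ∫⁻ z in Metric.ball 0 r, rearrangementGain K u v z = 0) :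
    (∀ x, u x ≤ v x) ∨ (∀ x, v x ≤ u x) := by
  by_contra! hcon
  obtain ⟨⟨y, hy⟩, ⟨x, hx⟩⟩ := hcon
  have hall : ∀ᵐ z, rearrangementGain K u v z = 0 := by
    have h1 : ∀ n : ℕ, ∀ᵐ z, z ∈ Metric.ball (0 : Plane × Plane) n →
        rearrangementGain K u v z = 0 := by
      intro n
      rw [← ae_restrict_iff' Metric.isOpen_ball.measurableSet]
      exact (lintegral_eq_zero_iff (hK.measurable_rearrangementGain hu.measurable
        hv.measurable)).1 (h n)
    filter_upwards [ae_all_iff.2 h1] with z hz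
    obtain ⟨n, hn⟩ := exists_nat_gt ‖z‖
    exact hz n (by simpa using hn)
  have hst : ∀ᵐ z : Plane × Plane, StrictConvexOn ℝ univ fun t => K t (z.1 - z.2) :=
    (quasiMeasurePreserving_sub_of_right_invariant volume volume).ae hK.ae_strictConvexOn
  have hopen : IsOpen ({x | u x < v x} ×ˢ {y | v y < u y}) :=
    (isOpen_lt hu hv).prod (isOpen_lt hv hu)
  -- If neither function dominates, the crossing pairs form a nonempty open set, which cannot be
  -- null although the gain is positive almost everywhere on it.
  have hpos := hopen.measure_pos volume ⟨(x, y), hx, hy⟩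
  refine hpos.ne' (measure_mono_null ?_ (ae_iff.1 (hall.and hst)))
  rintro z ⟨hz1, hz2⟩ ⟨h1, h2⟩
  exact (rearrangementGain_pos h2 hz1 hz2).ne' h1

/-- Outside `[-1, 1]` the function `W` is arbitrary, so it is replaced by a continuous extension of
its restriction. -/
lemma ContinuousOn.measurable_comp_of_abs_le_one {X : Type*} [MeasurableSpace X] {W : ℝ → ℝ}
    (hW : ContinuousOn W (Icc (-1) 1)) {u : X → ℝ} (hu : Measurable u) (hb : ∀ x, |u x| ≤ 1) :
    Measurable fun x => W (u x) := by
  have h : Continuous (IccExtend (by norm_num : (-1 : ℝ) ≤ 1) ((Icc (-1) 1).domRestrict W)) :=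
    (continuousOn_iff_continuous_domRestrict.1 hW).Icc_extend'
  have h2 := h.measurable.comp hu
  convert h2 using 1
  ext x
  rw [Function.comp_apply, IccExtend_of_mem _ _ (abs_le.1 (hb x))]
  rfl

/-- Minimum and maximum permute the values of `u` and `v` at each point, so the potential terms
balance and the whole gain is kinetic. -/
lemma IsConvexKernel.nonlocalEnergy_min_add_max_add_gain {s p : ℝ} {K : ℝ → Plane → ℝ}
    (hK : IsConvexKernel s p K) {W : ℝ → ℝ} (hW : ContinuousOn W (Icc (-1) 1)) {u v : Plane → ℝ}
    (hu : Measurable u) (hv : Measurable v) (hub : ∀ x, |u x| ≤ 1) (hvb : ∀ x, |v x| ≤ 1)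
    (Ω : Set Plane) :
    nonlocalEnergy K W (fun x => min (u x) (v x)) Ω +
      nonlocalEnergy K W (fun x => max (u x) (v x)) Ω +
      ∫⁻ z in (Ωᶜ ×ˢ Ωᶜ)ᶜ, rearrangementGain K u v z =
      nonlocalEnergy K W u Ω + nonlocalEnergy K W v Ω := by
  have hmin : ∀ x, |min (u x) (v x)| ≤ 1 := fun x => by
    rcases min_choice (u x) (v x) with h | h <;> rw [h] <;> [exact hub x; exact hvb x]
  have hpot : (∫⁻ x in Ω, ENNReal.ofReal (W (min (u x) (v x)))) +
      ∫⁻ x in Ω, ENNReal.ofReal (W (max (u x) (v x))) =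
      (∫⁻ x in Ω, ENNReal.ofReal (W (u x))) + ∫⁻ x in Ω, ENNReal.ofReal (W (v x)) := by
    rw [← lintegral_add_left (hW.measurable_comp_of_abs_le_one (hu.min hv) hmin).ennreal_ofReal,
      ← lintegral_add_left (hW.measurable_comp_of_abs_le_one hu hub).ennreal_ofReal]
    refine lintegral_congr fun x => ?_
    rcases le_total (u x) (v x) with h | h
    · rw [min_eq_left h, max_eq_right h]
    · rw [min_eq_right h, max_eq_left h, add_comm]
  have hkin := hK.kineticEnergy_min_add_max_add_gain hu hv Ω
  simp only [nonlocalEnergy]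
  calc _ = (kineticEnergy K (fun x => min (u x) (v x)) Ω +
        kineticEnergy K (fun x => max (u x) (v x)) Ω +
        ∫⁻ z in (Ωᶜ ×ˢ Ωᶜ)ᶜ, rearrangementGain K u v z) +
        ((∫⁻ x in Ω, ENNReal.ofReal (W (min (u x) (v x)))) +
          ∫⁻ x in Ω, ENNReal.ofReal (W (max (u x) (v x)))) := by ring
    _ = _ := by rw [hkin, hpot]; ring

/-! ### One-dimensionality from ordered translates -/

open Filter Topology in
/-- A continuous function on the plane that is comparable with all its translates is
one-dimensional. -/
lemma exists_one_dimensional_of_translates_ordered {u : Plane → ℝ} (hu : Continuous u)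
    (hord : ∀ h : Plane, (∀ x, u x ≤ u (x + h)) ∨ (∀ x, u (x + h) ≤ u x)) :
    ∃ ω : Plane, ‖ω‖ = 1 ∧ ∃ u₀ : ℝ → ℝ, ∀ x, u x = u₀ (inner ℝ ω x) := by
  set A : Set Plane := {h | ∀ x, u x ≤ u (x + h)} with hA
  have hclosed : IsClosed A := by
    rw [hA, ofPred_forall]
    exact isClosed_iInter fun x => isClosed_le continuous_const (by fun_prop)
  have hneg : ∀ h, (∀ x, u (x + h) ≤ u x) → -h ∈ A := fun h hh x => by
    simpa using hh (x + -h)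
  have hzero : (0 : Plane) ∈ A := fun x => by simp
  have hadd : ∀ h k, h ∈ A → k ∈ A → h + k ∈ A := fun h k hh hk x => by
    rw [← add_assoc]; exact (hh x).trans (hk _)
  have hnsmul : ∀ (n : ℕ) h, h ∈ A → n • h ∈ A := by
    intro n h hh
    induction n with
    | zero => simpa using hzero
    | succ k ih => rw [succ_nsmul]; exact hadd _ _ ih hh
  -- If `h ∉ A`, then `u` never increases under steps by `h` and drops strictly at some `x`. It
  -- cannot recover after `n` further steps.
  have hdiv : ∀ (n : ℕ) h, (n + 1) • h ∈ A → h ∈ A := by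
    intro n h hh
    by_contra hcon
    have hle := (hord h).resolve_left hcon
    have hcon' : ∃ x, u (x + h) < u x := by simpa [hA] using hcon
    obtain ⟨x, hx⟩ := hcon'
    have h1 := hnsmul n _ (hneg h hle) (x + h + n • h)
    rw [smul_neg, add_neg_cancel_right] at h1
    have h2 := hh x
    rw [succ_nsmul', ← add_assoc] at h2
    linarith
  -- Rational multiples `⌊t n⌋ / n` follow from `hnsmul` and `hdiv`; real ones follow since `A` is
  -- closed.
  have hsmul : ∀ (t : ℝ) h, 0 ≤ t → h ∈ A → t • h ∈ A := by
    intro t h ht hh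
    have hlim : Tendsto (fun n : ℕ => ((⌊t * (n : ℝ)⌋₊ : ℝ) / (n : ℝ)) • h) atTop (𝓝 (t • h)) :=
      ((tendsto_nat_floor_mul_div_atTop ht).comp tendsto_natCast_atTop_atTop).smul_const h
    refine hclosed.mem_of_tendsto hlim ((eventually_gt_atTop 0).mono fun n hn => ?_)
    obtain ⟨m, rfl⟩ := Nat.exists_eq_succ_of_ne_zero hn.ne'
    refine hdiv m _ ?_
    rw [← Nat.cast_smul_eq_nsmul ℝ, smul_smul,
      mul_div_cancel₀ _ (by exact_mod_cast Nat.succ_ne_zero m), Nat.cast_smul_eq_nsmul]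
    exact hnsmul _ _ hh
  have hAneg : IsClosed {h | -h ∈ A} := hclosed.preimage continuous_neg
  have hrank : 1 < Module.rank ℝ Plane := by
    rw [← Module.finrank_eq_rank, finrank_euclideanSpace_fin]; norm_num
  have hcover : Metric.sphere (0 : Plane) 1 ⊆ A ∪ {h | -h ∈ A} := fun h _ =>
    (hord h).imp id (hneg h)
  have hne : (Metric.sphere (0 : Plane) 1 ∩ A).Nonempty := by
    set e : Plane := EuclideanSpace.single 0 1
    have he : e ∈ Metric.sphere (0 : Plane) 1 := by simp [e]
    rcases hcover he with h | h
    · exact ⟨e, he, h⟩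
    · exact ⟨-e, by simpa using he, h⟩
  have hne' : (Metric.sphere (0 : Plane) 1 ∩ {h | -h ∈ A}).Nonempty := by
    obtain ⟨e, he, h⟩ := hne
    exact ⟨-e, by simpa using he, by simpa using h⟩
  obtain ⟨e, he, heA, heA'⟩ := isPreconnected_closed_iff.1
    (isPreconnected_sphere hrank (0 : Plane) 1) _ _ hclosed hAneg hcover hne hne'
  have hinv : ∀ (t : ℝ) x, u (x + t • e) = u x := by
    have key : ∀ t : ℝ, t • e ∈ A := by
      intro t
      rcases le_total 0 t with ht | ht
      · exact hsmul t e ht heA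
      · simpa using hsmul (-t) (-e) (by linarith) heA'
    intro t x
    refine le_antisymm ?_ (key t x)
    have := key (-t) (x + t • e)
    rwa [neg_smul, add_neg_cancel_right] at this
  have hen : e 0 ^ 2 + e 1 ^ 2 = 1 := by
    have : ‖e‖ = 1 := by simpa using he
    rw [EuclideanSpace.norm_eq, Real.sqrt_eq_one] at this
    simpa [Fin.sum_univ_two] using this
  -- The direction `ω` is `e` rotated by a right angle; in the plane it spans the orthogonal
  -- complement of `e`.
  refine ⟨!₂[-e 1, e 0], ?_, fun r => u (r • !₂[-e 1, e 0]), fun x => ?_⟩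
  · rw [EuclideanSpace.norm_eq, Real.sqrt_eq_one]
    simp [Fin.sum_univ_two]
    linarith
  · have hin : inner ℝ (!₂[-e 1, e 0] : Plane) x = -(e 1) * x 0 + e 0 * x 1 := by
      simp [PiLp.inner_apply, Fin.sum_univ_two]; ring
    have hx : x = (inner ℝ (!₂[-e 1, e 0] : Plane) x) • !₂[-e 1, e 0] +
        (e 0 * x 0 + e 1 * x 1) • e := by
      rw [hin]
      ext i
      fin_cases i
      · simp; linear_combination (-(x 0)) * hen
      · simp; linear_combination (-(x 1)) * hen
    conv_lhs => rw [hx]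
    exact hinv _ _

/-! ### Deformation of the domain -/

/-- The maps `x ↦ x + g x • h`, with `g` of Lipschitz constant small with respect to `h`, are
homeomorphisms. -/
lemma exists_homeomorph_add_smul {g : Plane → ℝ} {h : Plane} {ε : ℝ} (hε : ε ≤ 1 / 2)
    (hg : ∀ x y, ‖(g x - g y) • h‖ ≤ ε * ‖x - y‖) :
    ∃ Φ : Plane ≃ₜ Plane, ∀ x, Φ x = x + g x • h := by
  -- A perturbation of the identity with Lipschitz constant `1 / 2 < 1` is globally invertible.
  have happ : ApproximatesLinearOn (fun x => x + g x • h)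
      ((ContinuousLinearEquiv.refl ℝ Plane : Plane ≃L[ℝ] Plane) : Plane →L[ℝ] Plane) univ
      (1 / 2 : NNReal) := by
    intro x _ y _
    have h1 : x + g x • h - (y + g y • h) - (x - y) = (g x - g y) • h := by
      rw [sub_smul]; abel
    have h2 : (1 / 2 : NNReal) = (1 / 2 : ℝ) := by norm_num
    simp only [ContinuousLinearEquiv.coe_refl, ContinuousLinearMap.coe_id', id_eq]
    rw [h1, h2]
    exact (hg x y).trans (by gcongr)
  refine ⟨happ.toHomeomorph _ (Or.inr ?_), fun x => rfl⟩
  have : ‖(((ContinuousLinearEquiv.refl ℝ Plane).symm : Plane ≃L[ℝ] Plane) :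
      Plane →L[ℝ] Plane)‖₊ = 1 := by
    rw [ContinuousLinearEquiv.refl_symm, ContinuousLinearEquiv.coe_refl]
    exact nnnorm_one
  rw [this, inv_one]
  exact NNReal.half_lt_self one_ne_zero

/-- The data of a small deformation `Φ x = x + g x • h` of the plane. -/
structure IsDeformation (g : Plane → ℝ) (h : Plane) (ε : ℝ) (Φ : Plane ≃ₜ Plane) : Prop where
  contDiff : ContDiff ℝ 1 g
  nonneg : 0 ≤ ε
  le_half : ε ≤ 1 / 2
  lipschitz : ∀ x y, ‖(g x - g y) • h‖ ≤ ε * ‖x - y‖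
  eq : ∀ x, Φ x = x + g x • h

namespace IsDeformation

variable {g : Plane → ℝ} {h : Plane} {ε : ℝ} {Φ : Plane ≃ₜ Plane}

lemma sub_eq (hΦ : IsDeformation g h ε Φ) (x y : Plane) :
    Φ x - Φ y = (x - y) + (g x - g y) • h := by
  rw [hΦ.eq, hΦ.eq, sub_smul]; abel

lemma abs_fderiv_le (hΦ : IsDeformation g h ε Φ) (x : Plane) : |fderiv ℝ g x h| ≤ ε := by
  rcases eq_or_ne h 0 with rfl | hh
  · simpa using hΦ.nonneg
  have hpos : 0 < ‖h‖ := norm_pos_iff.2 hh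
  have hlip : ‖fderiv ℝ g x‖ ≤ ε / ‖h‖ := by
    refine norm_fderiv_le_of_lip' ℝ (div_nonneg hΦ.nonneg hpos.le) (Filter.Eventually.of_forall ?_)
    intro y
    have := hΦ.lipschitz y x
    rw [norm_smul] at this
    rw [div_mul_eq_mul_div, le_div_iff₀ hpos]
    exact this
  calc |fderiv ℝ g x h| ≤ ‖fderiv ℝ g x‖ * ‖h‖ := (fderiv ℝ g x).le_opNorm h
    _ ≤ ε / ‖h‖ * ‖h‖ := by gcongr
    _ = ε := div_mul_cancel₀ _ hpos.ne'

lemma continuous_fderiv_apply (hΦ : IsDeformation g h ε Φ) :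
    Continuous fun x => fderiv ℝ g x h :=
  (hΦ.contDiff.continuous_fderiv (by norm_num)).clm_apply continuous_const

lemma measurable_density (hΦ : IsDeformation g h ε Φ) :
    Measurable fun x => ENNReal.ofReal (1 + fderiv ℝ g x h) :=
  (hΦ.continuous_fderiv_apply.measurable.const_add 1).ennreal_ofReal

/-- The derivative of `Φ` is a rank one perturbation of the identity, so its determinant is exactly
`1 + Dg(h)`, positive since `ε ≤ 1 / 2`. Being affine in `h`, it lets opposite deformations cancel
without remainder. -/
lemma map_withDensity (hΦ : IsDeformation g h ε Φ) :
    Measure.map Φ (volume.withDensity fun x => ENNReal.ofReal (1 + fderiv ℝ g x h)) = volume := by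
  have hder : ∀ x ∈ (univ : Set Plane), HasFDerivWithinAt Φ
      (ContinuousLinearMap.id ℝ Plane + (fderiv ℝ g x).smulRight h) univ x := by
    intro x _
    have h1 : HasFDerivAt (fun x => x + g x • h)
        (ContinuousLinearMap.id ℝ Plane + (fderiv ℝ g x).smulRight h) x :=
      (hasFDerivAt_id x).add
        ((hΦ.contDiff.differentiable (by norm_num) x).hasFDerivAt.smul_const h)
    exact (h1.congr_of_eventuallyEq (Filter.Eventually.of_forall hΦ.eq)).hasFDerivWithinAt
  have key := map_withDensity_abs_det_fderiv_eq_addHaar volume (f := Φ)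
    MeasurableSet.univ.nullMeasurableSet hder Φ.injective.injOn
  rw [Measure.restrict_univ, image_univ, Φ.surjective.range_eq, Measure.restrict_univ] at key
  have hdet : ∀ x, |(ContinuousLinearMap.id ℝ Plane + (fderiv ℝ g x).smulRight h).det| =
      1 + fderiv ℝ g x h := by
    intro x
    have : (ContinuousLinearMap.id ℝ Plane + (fderiv ℝ g x).smulRight h).det =
        1 + fderiv ℝ g x h := LinearMap.transvection.det (fderiv ℝ g x).toLinearMap h
    rw [this, abs_of_nonneg]
    linarith [(abs_le.1 (hΦ.abs_fderiv_le x)).1, hΦ.le_half]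
  simp only [hdet] at key
  exact key

lemma lintegral_eq (hΦ : IsDeformation g h ε Φ) {H : Plane → ℝ≥0∞} (hH : Measurable H) :
    ∫⁻ x, H x = ∫⁻ x, ENNReal.ofReal (1 + fderiv ℝ g x h) * H (Φ x) := by
  conv_lhs => rw [← hΦ.map_withDensity]
  rw [lintegral_map hH Φ.measurable]
  exact lintegral_withDensity_eq_lintegral_mul _ hΦ.measurable_density (hH.comp Φ.measurable)

lemma lintegral_prod_eq (hΦ : IsDeformation g h ε Φ) {H : Plane × Plane → ℝ≥0∞}
    (hH : Measurable H) :
    ∫⁻ z, H z = ∫⁻ z : Plane × Plane, ENNReal.ofReal (1 + fderiv ℝ g z.1 h) *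
      ENNReal.ofReal (1 + fderiv ℝ g z.2 h) * H (Φ z.1, Φ z.2) := by
  have hm := hΦ.measurable_density
  have hvol : (volume : Measure (Plane × Plane)) = Measure.map (Prod.map Φ Φ)
      (volume.withDensity fun z : Plane × Plane => ENNReal.ofReal (1 + fderiv ℝ g z.1 h) *
        ENNReal.ofReal (1 + fderiv ℝ g z.2 h)) := by
    rw [Measure.volume_eq_prod, ← prod_withDensity hm hm,
      ← Measure.map_prod_map _ _ Φ.measurable Φ.measurable, hΦ.map_withDensity]
  have hΦm : Measurable (Prod.map Φ Φ) := Φ.measurable.prodMap Φ.measurable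
  conv_lhs => rw [hvol]
  rw [lintegral_map hH hΦm]
  exact lintegral_withDensity_eq_lintegral_mul _
    ((hm.comp measurable_fst).mul (hm.comp measurable_snd)) (hH.comp hΦm)

lemma mem_iff (hΦ : IsDeformation g h ε Φ) {Ω : Set Plane} (hg : ∀ x, x ∉ Ω → g x = 0)
    (x : Plane) : Φ x ∈ Ω ↔ x ∈ Ω := by
  have hfix : ∀ y, y ∉ Ω → Φ y = y := fun y hy => by rw [hΦ.eq, hg y hy, zero_smul, add_zero]
  constructor
  · intro hx
    by_contra hcon
    rw [hfix x hcon] at hx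
    exact hcon hx
  · intro hx
    by_contra hcon
    rw [Φ.injective (hfix _ hcon)] at hcon
    exact hcon hx

lemma setLIntegral_comp_symm (hΦ : IsDeformation g h ε Φ) {Ω : Set Plane} (hΩ : MeasurableSet Ω)
    (hg : ∀ x, x ∉ Ω → g x = 0) {w : Plane → ℝ≥0∞} (hw : Measurable w) :
    ∫⁻ x in Ω, w (Φ.symm x) = ∫⁻ x in Ω, ENNReal.ofReal (1 + fderiv ℝ g x h) * w x := by
  rw [← lintegral_indicator hΩ, ← lintegral_indicator hΩ,
    hΦ.lintegral_eq ((show Measurable fun x => w (Φ.symm x) from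
      hw.comp Φ.symm.measurable).indicator hΩ)]
  refine lintegral_congr fun x => ?_
  by_cases hx : x ∈ Ω
  · rw [indicator_of_mem hx, indicator_of_mem ((hΦ.mem_iff hg x).2 hx), Φ.symm_apply_apply]
  · rw [indicator_of_notMem hx, indicator_of_notMem (mt (hΦ.mem_iff hg x).1 hx), mul_zero]

/-- The change of variables preserves the domain of integration and moves the deformation from `u`
to the kernel, so no derivative of `u` is needed. -/
lemma kineticEnergy_comp_symm (hΦ : IsDeformation g h ε Φ) {s p : ℝ} {K : ℝ → Plane → ℝ}
    (hK : IsConvexKernel s p K) {u : Plane → ℝ} (hu : Measurable u) {Ω : Set Plane}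
    (hΩ : MeasurableSet Ω) (hg : ∀ x, x ∉ Ω → g x = 0) :
    kineticEnergy K (fun x => u (Φ.symm x)) Ω = ∫⁻ z in (Ωᶜ ×ˢ Ωᶜ)ᶜ,
      ENNReal.ofReal (1 + fderiv ℝ g z.1 h) * ENNReal.ofReal (1 + fderiv ℝ g z.2 h) *
        ENNReal.ofReal (K (u z.1 - u z.2) ((z.1 - z.2) + (g z.1 - g z.2) • h)) := by
  have hD : MeasurableSet (Ωᶜ ×ˢ Ωᶜ)ᶜ := (hΩ.compl.prod hΩ.compl).compl
  rw [kineticEnergy, ← lintegral_indicator hD, ← lintegral_indicator hD,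
    hΦ.lintegral_prod_eq ((hK.measurable_ofReal_interaction
      (show Measurable fun x => u (Φ.symm x) from hu.comp Φ.symm.measurable)).indicator hD)]
  refine lintegral_congr fun z => ?_
  have hz : (Φ z.1, Φ z.2) ∈ (Ωᶜ ×ˢ Ωᶜ)ᶜ ↔ z ∈ (Ωᶜ ×ˢ Ωᶜ)ᶜ := by
    simp only [mem_compl_iff, mem_prod, hΦ.mem_iff hg]
  by_cases hx : z ∈ (Ωᶜ ×ˢ Ωᶜ)ᶜ
  · rw [indicator_of_mem hx, indicator_of_mem (hz.2 hx)]
    simp only [Φ.symm_apply_apply, hΦ.sub_eq]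
  · rw [indicator_of_notMem hx, indicator_of_notMem (mt hz.1 hx), mul_zero]

end IsDeformation

/-- The energies of the two opposite deformations of `u` exceed twice the energy of `u` by a term
of second order. -/
lemma IsConvexKernel.exists_deformation_bound {s p : ℝ} {K : ℝ → Plane → ℝ}
    (hK : IsConvexKernel s p K) :
    ∃ C : ℝ, 0 ≤ C ∧ ∀ {W : ℝ → ℝ}, ContinuousOn W (Icc (-1) 1) →
      ∀ {u g : Plane → ℝ} {h : Plane} {ε : ℝ} {Φ Ψ : Plane ≃ₜ Plane} {S Ω : Set Plane},
      Measurable u → (∀ x, |u x| ≤ 1) → IsDeformation g h ε Φ → IsDeformation g (-h) ε Ψ →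
      MeasurableSet S → MeasurableSet Ω → S ⊆ Ω → tsupport g ⊆ S →
      nonlocalEnergy K W (fun x => u (Φ.symm x)) Ω + nonlocalEnergy K W (fun x => u (Ψ.symm x)) Ω ≤
        2 * nonlocalEnergy K W u Ω + ENNReal.ofReal (C * ε ^ 2) * kineticEnergy K u S := by
  obtain ⟨C, hC, hC'⟩ := hK.second_variation
  refine ⟨C, hC, ?_⟩
  intro W hWc u g h ε Φ Ψ S Ω hu hub hΦ hΨ hS hΩ hSΩ hgS
  have hgS0 : ∀ x, x ∉ S → g x = 0 := fun x hx => image_eq_zero_of_notMem_tsupport (mt (@hgS x) hx)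
  have hdS0 : ∀ x, x ∉ S → fderiv ℝ g x = 0 := fun x hx =>
    fderiv_of_notMem_tsupport ℝ (mt (@hgS x) hx)
  have hgΩ : ∀ x, x ∉ Ω → g x = 0 := fun x hx => hgS0 x (mt (@hSΩ x) hx)
  have hWu : Measurable fun x => ENNReal.ofReal (W (u x)) :=
    (hWc.measurable_comp_of_abs_le_one hu hub).ennreal_ofReal
  -- The Jacobians of the two deformations add up to `2`, so the potential contributes no error.
  have hpot : (∫⁻ x in Ω, ENNReal.ofReal (W (u (Φ.symm x)))) +
      ∫⁻ x in Ω, ENNReal.ofReal (W (u (Ψ.symm x))) = 2 * ∫⁻ x in Ω, ENNReal.ofReal (W (u x)) := by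
    rw [hΦ.setLIntegral_comp_symm hΩ hgΩ hWu, hΨ.setLIntegral_comp_symm hΩ hgΩ hWu,
      ← lintegral_add_left (show Measurable fun x => _ * _ from hΦ.measurable_density.mul hWu),
      ← lintegral_const_mul _ hWu]
    refine lintegral_congr fun x => ?_
    have hb := abs_le.1 (hΦ.abs_fderiv_le x)
    have hh := hΦ.le_half
    rw [map_neg, ← add_mul, ← ENNReal.ofReal_add (by linarith) (by linarith)]
    congr 1
    rw [show 1 + fderiv ℝ g x h + (1 + -fderiv ℝ g x h) = 2 by ring]
    norm_num
  have hI := hK.measurable_ofReal_interaction hu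
  have hDS : MeasurableSet (Sᶜ ×ˢ Sᶜ)ᶜ := (hS.compl.prod hS.compl).compl
  have hsub : (Sᶜ ×ˢ Sᶜ)ᶜ ⊆ (Ωᶜ ×ˢ Ωᶜ)ᶜ := compl_subset_compl.2
    (prod_mono (compl_subset_compl.2 hSΩ) (compl_subset_compl.2 hSΩ))
  have hkin : kineticEnergy K (fun x => u (Φ.symm x)) Ω +
      kineticEnergy K (fun x => u (Ψ.symm x)) Ω ≤
      2 * kineticEnergy K u Ω + ENNReal.ofReal (C * ε ^ 2) * kineticEnergy K u S := by
    have hkS : kineticEnergy K u S = ∫⁻ z in (Ωᶜ ×ˢ Ωᶜ)ᶜ, (Sᶜ ×ˢ Sᶜ)ᶜ.indicator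
        (fun z => ENNReal.ofReal (K (u z.1 - u z.2) (z.1 - z.2))) z := by
      rw [lintegral_indicator hDS, Measure.restrict_restrict hDS, inter_eq_left.2 hsub]
      rfl
    rw [hΦ.kineticEnergy_comp_symm hK hu hΩ hgΩ, hΨ.kineticEnergy_comp_symm hK hu hΩ hgΩ, hkS,
      kineticEnergy, ← lintegral_const_mul _ hI,
      ← lintegral_const_mul _ (hI.indicator hDS), ← lintegral_add_left (hI.const_mul 2),
      ← lintegral_add_left]
    · refine lintegral_mono fun z => ?_
      have hh := hΦ.le_half
      have hb1 := hΦ.abs_fderiv_le z.1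
      have hb2 := hΦ.abs_fderiv_le z.2
      have hb1' := abs_le.1 hb1
      have hb2' := abs_le.1 hb2
      have p1 : 0 ≤ 1 + fderiv ℝ g z.1 h := by linarith
      have p2 : 0 ≤ 1 + -fderiv ℝ g z.1 h := by linarith
      have p3 : 0 ≤ 1 + fderiv ℝ g z.2 h := by linarith
      simp only [map_neg, smul_neg, ← sub_eq_add_neg] at *
      rw [← ENNReal.ofReal_mul p1, ← ENNReal.ofReal_mul p2,
        ← ENNReal.ofReal_mul (mul_nonneg p1 p3),
        ← ENNReal.ofReal_mul (mul_nonneg p2 (by linarith)),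
        ← ENNReal.ofReal_add (mul_nonneg (mul_nonneg p1 p3) (hK.nonneg _ _))
          (mul_nonneg (mul_nonneg p2 (by linarith)) (hK.nonneg _ _))]
      have h2 : ∀ k : ℝ, 2 * ENNReal.ofReal k = ENNReal.ofReal (2 * k) := fun k => by
        rw [ENNReal.ofReal_mul (by norm_num)]; norm_num
      -- For pairs outside `S` both deformations are trivial; the error is charged only to pairs
      -- meeting `S`.
      by_cases hz : z ∈ (Sᶜ ×ˢ Sᶜ)ᶜ
      · rw [indicator_of_mem hz, h2,
          ← ENNReal.ofReal_mul (by positivity), ← ENNReal.ofReal_add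
          (mul_nonneg (by norm_num) (hK.nonneg _ _)) (mul_nonneg (by positivity) (hK.nonneg _ _))]
        refine ENNReal.ofReal_le_ofReal ?_
        have := hC' (u z.1 - u z.2) ε _ _ (z.1 - z.2) ((g z.1 - g z.2) • h) hh
          (hΦ.lipschitz _ _) hb1 hb2
        linarith
      · rw [indicator_of_notMem hz, mul_zero, add_zero, h2]
        rw [notMem_compl_iff] at hz
        rw [hgS0 _ hz.1, hgS0 _ hz.2, hdS0 _ hz.1, hdS0 _ hz.2]
        refine ENNReal.ofReal_le_ofReal (le_of_eq ?_)
        simp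
        ring
    · have hgm : Measurable g := hΦ.contDiff.continuous.measurable
      exact ((hΦ.measurable_density.comp measurable_fst).mul
        (hΦ.measurable_density.comp measurable_snd)).mul
        (hK.measurable.comp (by fun_prop : Measurable fun z : Plane × Plane =>
          (u z.1 - u z.2, (z.1 - z.2) + (g z.1 - g z.2) • h))).ennreal_ofReal
  simp only [nonlocalEnergy]
  calc _ = (kineticEnergy K (fun x => u (Φ.symm x)) Ω + kineticEnergy K (fun x => u (Ψ.symm x)) Ω) +
        ((∫⁻ x in Ω, ENNReal.ofReal (W (u (Φ.symm x)))) +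
          ∫⁻ x in Ω, ENNReal.ofReal (W (u (Ψ.symm x)))) := by ring
    _ ≤ (2 * kineticEnergy K u Ω + ENNReal.ofReal (C * ε ^ 2) * kineticEnergy K u S) +
        2 * ∫⁻ x in Ω, ENNReal.ofReal (W (u x)) := by rw [hpot]; gcongr
    _ = _ := by ring

/-! ### The energy of a minimizer in large balls -/

/-- The kernel controlling the kinetic energy of functions with values in `[-1, 1]` and Lipschitz
constant `2 / L`. -/
noncomputable def truncatedKernel (s p L : ℝ) (x : Plane) : ℝ :=
  min 2 (2 * ‖x‖ / L) ^ p / ‖x‖ ^ (2 + s * p)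

lemma measurable_truncatedKernel (s p L : ℝ) : Measurable (truncatedKernel s p L) := by
  unfold truncatedKernel
  fun_prop

/-- In polar coordinates the integrand is a multiple of `r ^ (p - 1 - s * p)` near zero, integrable
as `s < 1`, and of `r ^ (-1 - s * p)` at infinity, integrable as `s * p > 0`. -/
lemma integrable_truncatedKernel_one {s p : ℝ} (hs₀ : 0 < s) (hs₁ : s < 1) (hp : 1 ≤ p) :
    Integrable (truncatedKernel s p 1) := by
  have hsp : 0 < s * p := by positivity
  have hsp' : s * p < p := by nlinarith
  have key := integrable_fun_norm_addHaar (volume : Measure Plane)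
    (f := fun r : ℝ => min 2 (2 * r / 1) ^ p / r ^ (2 + s * p))
  refine key.2 ?_
  rw [finrank_euclideanSpace_fin, ← Ioc_union_Ioi_eq_Ioi (zero_le_one (α := ℝ))]
  refine IntegrableOn.union ?_ ?_
  · have h1 : IntegrableOn (fun y : ℝ => 2 ^ p * y ^ (p - 1 - s * p)) (Ioc 0 1) :=
      (((intervalIntegrable_iff_integrableOn_Ioc_of_le zero_le_one).1
        (intervalIntegral.intervalIntegrable_rpow' (by linarith))).const_mul _)
    refine h1.congr_fun (fun y hy => ?_) measurableSet_Ioc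
    have hy0 : 0 < y := hy.1
    simp only [div_one, smul_eq_mul]
    rw [min_eq_right (by linarith [hy.2]), Real.mul_rpow (by norm_num) hy0.le,
      show p - 1 - s * p = p + 1 - (2 + s * p) by ring, Real.rpow_sub hy0, Real.rpow_add hy0,
      Real.rpow_one, show 2 - 1 = 1 from rfl, pow_one]
    ring
  · have h1 : IntegrableOn (fun y : ℝ => 2 ^ p * y ^ (-1 - s * p)) (Ioi 1) :=
      (integrableOn_Ioi_rpow_of_lt (by linarith) zero_lt_one).const_mul _
    refine h1.congr_fun (fun y hy => ?_) measurableSet_Ioi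
    have hy0 : 0 < y := zero_lt_one.trans hy
    simp only [div_one, smul_eq_mul]
    rw [min_eq_left (by linarith [mem_Ioi.1 hy]),
      show -1 - s * p = 1 - (2 + s * p) by ring, Real.rpow_sub hy0,
      Real.rpow_one, show 2 - 1 = 1 from rfl, pow_one]
    ring

-- Dominated convergence with the kernel for `L = 1` as majorant. No rate is needed, so no case
-- distinction on `s * p` arises.
open Filter Topology in
lemma tendsto_lintegral_truncatedKernel {s p : ℝ} (hs₀ : 0 < s) (hs₁ : s < 1) (hp : 1 ≤ p) :
    Tendsto (fun L : ℝ => ∫⁻ x, ENNReal.ofReal (truncatedKernel s p L x)) atTop (𝓝 0) := by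
  have hp0 : 0 < p := by linarith
  have := tendsto_lintegral_filter_of_dominated_convergence (μ := (volume : Measure Plane))
    (l := atTop) (F := fun (L : ℝ) x => ENNReal.ofReal (truncatedKernel s p L x)) (f := fun _ => 0)
    (fun x => ENNReal.ofReal (truncatedKernel s p 1 x))
    (Eventually.of_forall fun L => (measurable_truncatedKernel s p L).ennreal_ofReal)
    ((eventually_ge_atTop 1).mono fun L hL => Eventually.of_forall fun x => ?_)
    (integrable_truncatedKernel_one hs₀ hs₁ hp).lintegral_lt_top.ne
    (Eventually.of_forall fun x => ?_)
  · simpa using this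
  · have hL0 : 0 < L := by linarith
    refine ENNReal.ofReal_le_ofReal ?_
    unfold truncatedKernel
    gcongr
  · have h1 : Tendsto (fun L : ℝ => 2 * ‖x‖ / L) atTop (𝓝 0) :=
      tendsto_const_nhds.div_atTop tendsto_id
    have h2 : Tendsto (fun L : ℝ => truncatedKernel s p L x) atTop
        (𝓝 (min 2 0 ^ p / ‖x‖ ^ (2 + s * p))) :=
      (((tendsto_const_nhds.min h1).rpow_const (Or.inr hp0.le))).div_const _
    rw [min_eq_right (by norm_num), Real.zero_rpow hp0.ne', zero_div] at h2
    simpa using ENNReal.tendsto_ofReal h2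

/-- Integrals of a convolution kernel over the pairs of points that meet `B`. -/
lemma setLIntegral_compl_prod_compl_compl_le {k : Plane → ℝ≥0∞} (hk : Measurable k)
    (B : Set Plane) :
    ∫⁻ z in (Bᶜ ×ˢ Bᶜ)ᶜ, k (z.1 - z.2) ≤ 2 * volume B * ∫⁻ x, k x := by
  have hkm : Measurable fun z : Plane × Plane => k (z.1 - z.2) := hk.comp (by fun_prop)
  have hset : (Bᶜ ×ˢ Bᶜ)ᶜ = (B ×ˢ (univ : Set Plane)) ∪ ((univ : Set Plane) ×ˢ B) := by
    rw [compl_prod_eq_union, compl_compl]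
  have h1 : ∫⁻ z in B ×ˢ (univ : Set Plane), k (z.1 - z.2) = volume B * ∫⁻ x, k x := by
    rw [Measure.volume_eq_prod, ← Measure.prod_restrict, lintegral_prod _ hkm.aemeasurable]
    simp only [Measure.restrict_univ, lintegral_sub_left_eq_self]
    rw [setLIntegral_const, mul_comm]
  have h2 : ∫⁻ z in (univ : Set Plane) ×ˢ B, k (z.1 - z.2) = volume B * ∫⁻ x, k x := by
    rw [Measure.volume_eq_prod, ← Measure.prod_restrict, lintegral_prod_symm _ hkm.aemeasurable]
    simp only [Measure.restrict_univ, lintegral_sub_right_eq_self]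
    rw [setLIntegral_const, mul_comm]
  rw [hset]
  refine (lintegral_union_le _ _ _).trans (le_of_eq ?_)
  rw [h1, h2]
  ring

lemma IsConvexKernel.exists_interaction_le_truncatedKernel {s p : ℝ} {K : ℝ → Plane → ℝ}
    (hK : IsConvexKernel s p K) (hp : 1 ≤ p) :
    ∃ c : ℝ, 0 < c ∧ ∀ (L t : ℝ) (x : Plane), |t| ≤ min 2 (2 * ‖x‖ / L) →
      ENNReal.ofReal (K t x) ≤ ENNReal.ofReal (c * truncatedKernel s p L x) := by
  obtain ⟨c, hc, h⟩ := hK.upper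
  refine ⟨c, hc, fun L t x ht => ENNReal.ofReal_le_ofReal ((h t x).trans ?_)⟩
  unfold truncatedKernel
  gcongr

/-- The radial function equal to `-1` in the ball of radius `R - L` and to `1` outside the ball of
radius `R`, and interpolating linearly in between. -/
noncomputable def radialBarrier (R L : ℝ) (x : Plane) : ℝ :=
  max (-1) (min 1 (1 - 2 * (R - ‖x‖) / L))

section radialBarrier

variable {R L : ℝ}

lemma continuous_radialBarrier (R L : ℝ) : Continuous (radialBarrier R L) := by
  unfold radialBarrier
  fun_prop

lemma abs_radialBarrier_le_one (R L : ℝ) (x : Plane) : |radialBarrier R L x| ≤ 1 :=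
  abs_le.2 ⟨le_max_left _ _, max_le (by norm_num) (min_le_left _ _)⟩

lemma radialBarrier_eq_one (hL : 0 < L) {x : Plane} (hx : R ≤ ‖x‖) : radialBarrier R L x = 1 := by
  have : 2 * (R - ‖x‖) / L ≤ 0 := div_nonpos_of_nonpos_of_nonneg (by linarith) hL.le
  rw [radialBarrier, min_eq_left (by linarith), max_eq_right (by norm_num)]

lemma radialBarrier_eq_neg_one (hL : 0 < L) {x : Plane} (hx : ‖x‖ ≤ R - L) :
    radialBarrier R L x = -1 := by
  have : 2 ≤ 2 * (R - ‖x‖) / L := by rw [le_div_iff₀ hL]; linarith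
  rw [radialBarrier, max_eq_left]
  exact (min_le_right _ _).trans (by linarith)

lemma abs_radialBarrier_sub_le (hL : 0 < L) (x y : Plane) :
    |radialBarrier R L x - radialBarrier R L y| ≤ min 2 (2 * ‖x - y‖ / L) := by
  refine le_min ?_ ?_
  · have h1 := abs_le.1 (abs_radialBarrier_le_one R L x)
    have h2 := abs_le.1 (abs_radialBarrier_le_one R L y)
    exact abs_le.2 ⟨by linarith, by linarith⟩
  · unfold radialBarrier
    rw [max_comm, max_comm (-1)]
    refine (abs_max_sub_max_le_abs _ _ _).trans ?_
    rw [min_comm, min_comm 1]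
    refine (abs_inf_sub_inf_le_abs _ _ _).trans ?_
    have : 1 - 2 * (R - ‖x‖) / L - (1 - 2 * (R - ‖y‖) / L) = 2 * (‖x‖ - ‖y‖) / L := by
      field_simp; ring
    rw [this, abs_div, abs_of_pos hL, abs_mul, abs_two]
    gcongr
    exact abs_norm_sub_norm_le x y

end radialBarrier

/-- Replacing a minimizer by its maximum with a barrier that is above it outside `Ω`. -/
lemma IsConvexKernel.nonlocalEnergy_max_le {s p : ℝ} {K : ℝ → Plane → ℝ}
    (hK : IsConvexKernel s p K) {W : ℝ → ℝ} (hW : ContinuousOn W (Icc (-1) 1)) {u v : Plane → ℝ}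
    {Ω : Set Plane} (hu : IsEnergyMinimizer K W u Ω) (hv : Measurable v) (hub : ∀ x, |u x| ≤ 1)
    (hvb : ∀ x, |v x| ≤ 1) (huv : ∀ x, x ∉ Ω → u x ≤ v x) :
    nonlocalEnergy K W (fun x => max (u x) (v x)) Ω ≤ nonlocalEnergy K W v Ω := by
  have h1 := hK.nonlocalEnergy_min_add_max_add_gain hW hu.measurable hv hub hvb Ω
  -- The minimum agrees with `u` outside `Ω`, so it costs at least as much as `u`; submodularity
  -- then leaves at most the energy of `v` for the maximum.
  have h2 := hu.le_energy _ (hu.measurable.min hv)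
    (Filter.Eventually.of_forall fun x hx => min_eq_left (huv x hx))
  refine (ENNReal.add_le_add_iff_left hu.energy_lt_top.ne).1 ?_
  rw [← h1]
  exact (add_le_add_left h2 _).trans le_self_add

lemma volume_ball_sdiff_ball_le {R L : ℝ} (hL : 0 < L) (hLR : L ≤ R) :
    volume (Metric.ball (0 : Plane) R \ Metric.ball 0 (R - L)) ≤
      ENNReal.ofReal (2 * R * L) * volume (Metric.ball (0 : Plane) 1) := by
  rw [measure_sdiff (Metric.ball_subset_ball (by linarith))
    Metric.isOpen_ball.measurableSet.nullMeasurableSet measure_ball_lt_top.ne,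
    Measure.addHaar_ball _ _ (show 0 ≤ R by linarith),
    Measure.addHaar_ball _ _ (show 0 ≤ R - L by linarith),
    finrank_euclideanSpace_fin, ← ENNReal.sub_mul (fun _ _ => measure_ball_lt_top.ne),
    ← ENNReal.ofReal_sub _ (by positivity)]
  gcongr
  nlinarith [sq_nonneg L]

/-- The maximum of `u` and the radial barrier equals `u` in `B_{R-L}` and costs no more than the
barrier. The latter has kinetic energy at most `O(R²)` times the integral of the truncated kernel,
and potential energy only in a shell of area `O(R L)`. -/
lemma IsConvexKernel.exists_kineticEnergy_le {s p : ℝ} {K : ℝ → Plane → ℝ}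
    (hK : IsConvexKernel s p K) (hp : 1 ≤ p) {W : ℝ → ℝ} (hW : IsDoubleWell W) {u : Plane → ℝ}
    (hub : ∀ x, |u x| ≤ 1) (hmin : ∀ R : ℝ, 0 < R → IsEnergyMinimizer K W u (Metric.ball 0 R)) :
    ∃ c M : ℝ, 0 ≤ c ∧ 0 ≤ M ∧ ∀ R L : ℝ, 0 < L → 4 * L ≤ R →
      kineticEnergy K u (Metric.ball 0 (R / 2)) ≤
        ENNReal.ofReal (c * R ^ 2) * (∫⁻ x, ENNReal.ofReal (truncatedKernel s p L x)) +
          ENNReal.ofReal (M * (R * L)) := by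
  obtain ⟨c, hc, hcK⟩ := hK.exists_interaction_le_truncatedKernel hp
  have hWc : ContinuousOn W (Icc (-1) 1) := hW.contDiffOn.continuousOn
  obtain ⟨M, hM⟩ := isCompact_Icc.exists_bound_of_continuousOn hWc
  have hM0 : 0 ≤ M := (norm_nonneg _).trans (hM 1 (by norm_num))
  set b : ℝ := (volume (Metric.ball (0 : Plane) 1)).toReal with hb
  have hbv : volume (Metric.ball (0 : Plane) 1) = ENNReal.ofReal b :=
    (ENNReal.ofReal_toReal measure_ball_lt_top.ne).symm
  have hb0 : 0 ≤ b := ENNReal.toReal_nonneg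
  -- The `4` is `2 + 2`: one share for the barrier (`hψkin`), one for the pairs reaching beyond
  -- `B_{R-L}` (`hsplit`).
  refine ⟨4 * c * b, 2 * M * b, by positivity, by positivity, fun R L hL hLR => ?_⟩
  have hR : 0 < R := by linarith
  set κ : ℝ≥0∞ := ∫⁻ x, ENNReal.ofReal (truncatedKernel s p L x) with hκ
  set ψ := radialBarrier R L with hψ
  set B : Set Plane := Metric.ball 0 R with hB
  set S : Set Plane := Metric.ball 0 (R / 2) with hS
  have hBm : MeasurableSet B := Metric.isOpen_ball.measurableSet
  have hSm : MeasurableSet S := Metric.isOpen_ball.measurableSet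
  have hSB : S ⊆ B := Metric.ball_subset_ball (by linarith)
  have hkm : Measurable fun x : Plane => ENNReal.ofReal (c * truncatedKernel s p L x) :=
    ((measurable_truncatedKernel s p L).const_mul c).ennreal_ofReal
  have hkint : ∫⁻ x : Plane, ENNReal.ofReal (c * truncatedKernel s p L x) = ENNReal.ofReal c * κ := by
    rw [hκ, ← lintegral_const_mul _ (measurable_truncatedKernel s p L).ennreal_ofReal]
    simp only [ENNReal.ofReal_mul hc.le]
  have hBvol : volume B = ENNReal.ofReal (R ^ 2) * ENNReal.ofReal b := by
    rw [hB, Measure.addHaar_ball _ _ hR.le, finrank_euclideanSpace_fin, hbv]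
  have hψkin : kineticEnergy K ψ B ≤ 2 * volume B * (ENNReal.ofReal c * κ) := by
    rw [← hkint]
    refine (lintegral_mono fun z => ?_).trans (setLIntegral_compl_prod_compl_compl_le hkm B)
    exact hcK _ _ _ (abs_radialBarrier_sub_le hL z.1 z.2)
  have hψpot : ∫⁻ x in B, ENNReal.ofReal (W (ψ x)) ≤
      ENNReal.ofReal M * (ENNReal.ofReal (2 * R * L) * ENNReal.ofReal b) := by
    have hD : MeasurableSet (B \ Metric.ball 0 (R - L)) :=
      hBm.diff Metric.isOpen_ball.measurableSet
    calc ∫⁻ x in B, ENNReal.ofReal (W (ψ x))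
        ≤ ∫⁻ x in B, (B \ Metric.ball 0 (R - L)).indicator (fun _ => ENNReal.ofReal M) x := by
          refine setLIntegral_mono' hBm fun x hx => ?_
          by_cases hx' : x ∈ Metric.ball (0 : Plane) (R - L)
          · have : ‖x‖ < R - L := by simpa using hx'
            rw [hψ, radialBarrier_eq_neg_one hL this.le, hW.map_neg_one, ENNReal.ofReal_zero]
            exact zero_le
          · rw [indicator_of_mem (show x ∈ B \ Metric.ball 0 (R - L) from ⟨hx, hx'⟩)]
            refine ENNReal.ofReal_le_ofReal ((le_abs_self _).trans ?_)
            exact hM _ (abs_le.1 (abs_radialBarrier_le_one R L x))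
      _ ≤ ∫⁻ x, (B \ Metric.ball 0 (R - L)).indicator (fun _ => ENNReal.ofReal M) x :=
          setLIntegral_le_lintegral _ _
      _ = ENNReal.ofReal M * volume (B \ Metric.ball 0 (R - L)) := by
          rw [lintegral_indicator hD, setLIntegral_const]
      _ ≤ _ := by
          rw [← hbv]
          gcongr
          exact volume_ball_sdiff_ball_le hL (by linarith)
  have hmax : kineticEnergy K (fun x => max (u x) (ψ x)) B ≤
      2 * volume B * (ENNReal.ofReal c * κ) +
        ENNReal.ofReal M * (ENNReal.ofReal (2 * R * L) * ENNReal.ofReal b) := by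
    have h := hK.nonlocalEnergy_max_le hWc (hmin R hR)
      (continuous_radialBarrier R L).measurable hub (abs_radialBarrier_le_one R L)
      (fun x hx => by
        rw [radialBarrier_eq_one hL (by simpa using hx)]
        exact (abs_le.1 (hub x)).2)
    exact le_self_add.trans (h.trans (add_le_add hψkin hψpot))
  have humeas := (hmin R hR).measurable
  have hsplit : kineticEnergy K u S ≤ kineticEnergy K (fun x => max (u x) (ψ x)) B +
      2 * volume B * (ENNReal.ofReal c * κ) := by
    have hDS : MeasurableSet (Sᶜ ×ˢ Sᶜ)ᶜ := (hSm.compl.prod hSm.compl).compl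
    have hsub : (Sᶜ ×ˢ Sᶜ)ᶜ ⊆ (Bᶜ ×ˢ Bᶜ)ᶜ := compl_subset_compl.2
      (prod_mono (compl_subset_compl.2 hSB) (compl_subset_compl.2 hSB))
    -- Because `4 * L ≤ R`, such points are at distance at least `L`, where the truncation is `2`,
    -- the largest possible oscillation of `u`.
    have hfar : ∀ x y : Plane, ‖x‖ < R / 2 → R - L < ‖y‖ → 2 ≤ 2 * ‖x - y‖ / L := by
      intro x y hx hy
      have := norm_sub_norm_le y x
      rw [norm_sub_rev] at this
      rw [le_div_iff₀ hL]
      linarith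
    calc kineticEnergy K u S
        ≤ ∫⁻ z in (Sᶜ ×ˢ Sᶜ)ᶜ, (ENNReal.ofReal (K (max (u z.1) (ψ z.1) - max (u z.2) (ψ z.2))
            (z.1 - z.2)) + ENNReal.ofReal (c * truncatedKernel s p L (z.1 - z.2))) := by
          refine setLIntegral_mono' hDS fun z hz => ?_
          have hz' : ‖z.1‖ < R / 2 ∨ ‖z.2‖ < R / 2 := by
            rw [compl_prod_eq_union, compl_compl] at hz
            rcases hz with h | h
            · left; simpa [hS] using h.1
            · right; simpa [hS] using h.2
          by_cases hin : ‖z.1‖ ≤ R - L ∧ ‖z.2‖ ≤ R - L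
          · rw [hψ, radialBarrier_eq_neg_one hL hin.1, radialBarrier_eq_neg_one hL hin.2,
              max_eq_left (abs_le.1 (hub _)).1, max_eq_left (abs_le.1 (hub _)).1]
            exact le_self_add
          · refine le_trans (hcK L _ _ ?_) le_add_self
            have h2 : (2 : ℝ) ≤ 2 * ‖z.1 - z.2‖ / L := by
              rw [not_and_or, not_le, not_le] at hin
              rcases hz' with h | h
              · exact hfar _ _ h (hin.resolve_left (by linarith))
              · rw [norm_sub_rev]
                exact hfar _ _ h (hin.resolve_right (by linarith))
            rw [min_eq_left h2]
            have h1 := abs_le.1 (hub z.1)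
            have h2 := abs_le.1 (hub z.2)
            exact abs_le.2 ⟨by linarith, by linarith⟩
      _ = (∫⁻ z in (Sᶜ ×ˢ Sᶜ)ᶜ, ENNReal.ofReal (K (max (u z.1) (ψ z.1) - max (u z.2) (ψ z.2))
            (z.1 - z.2))) +
          ∫⁻ z in (Sᶜ ×ˢ Sᶜ)ᶜ, ENNReal.ofReal (c * truncatedKernel s p L (z.1 - z.2)) :=
          lintegral_add_left (hK.measurable_ofReal_interaction
            (humeas.max (continuous_radialBarrier R L).measurable)) _
      _ ≤ _ := by
          refine add_le_add (lintegral_mono_set hsub) ?_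
          rw [← hkint]
          refine (setLIntegral_compl_prod_compl_compl_le hkm S).trans ?_
          gcongr
  refine (hsplit.trans (add_le_add_left hmax _)).trans (le_of_eq ?_)
  have e1 : ENNReal.ofReal (4 * c * b * R ^ 2) = 4 * (ENNReal.ofReal c * (ENNReal.ofReal b *
      ENNReal.ofReal (R ^ 2))) := by
    rw [show 4 * c * b * R ^ 2 = 4 * (c * (b * R ^ 2)) by ring, ENNReal.ofReal_mul (by norm_num),
      ENNReal.ofReal_mul hc.le, ENNReal.ofReal_mul hb0]
    norm_num
  have e2 : ENNReal.ofReal (2 * M * b * (R * L)) =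
      ENNReal.ofReal M * (ENNReal.ofReal (2 * R * L) * ENNReal.ofReal b) := by
    rw [← ENNReal.ofReal_mul (by positivity), ← ENNReal.ofReal_mul hM0]
    congr 1
    ring
  rw [e1, e2, hBvol]
  ring

open Filter Topology in
/-- The kinetic energy of a minimizer in the ball of radius `R` is `o(R ^ 2)`, along
`R = L ^ 2 / 2`. -/
lemma IsConvexKernel.tendsto_kineticEnergy_div {s p : ℝ} {K : ℝ → Plane → ℝ} (hs₀ : 0 < s)
    (hs₁ : s < 1) (hp : 1 ≤ p) (hK : IsConvexKernel s p K) {W : ℝ → ℝ} (hW : IsDoubleWell W)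
    {u : Plane → ℝ} (hub : ∀ x, |u x| ≤ 1)
    (hmin : ∀ R : ℝ, 0 < R → IsEnergyMinimizer K W u (Metric.ball 0 R)) :
    Tendsto (fun L : ℝ => ENNReal.ofReal (1 / (L ^ 2) ^ 2) *
      kineticEnergy K u (Metric.ball 0 (L ^ 2 / 2))) atTop (𝓝 0) := by
  obtain ⟨c, M, hc, hM, h⟩ := hK.exists_kineticEnergy_le hp hW hub hmin
  have hlim : Tendsto (fun L : ℝ => ENNReal.ofReal c *
      (∫⁻ x, ENNReal.ofReal (truncatedKernel s p L x)) + ENNReal.ofReal (M / L)) atTop (𝓝 0) := by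
    have h1 := ENNReal.Tendsto.const_mul (a := ENNReal.ofReal c)
      (tendsto_lintegral_truncatedKernel hs₀ hs₁ hp) (Or.inr ENNReal.ofReal_ne_top)
    have h2 : Tendsto (fun L : ℝ => M / L) atTop (𝓝 0) := tendsto_const_nhds.div_atTop tendsto_id
    simpa using h1.add (ENNReal.tendsto_ofReal h2)
  refine tendsto_of_tendsto_of_tendsto_of_le_of_le' tendsto_const_nhds hlim
    (Eventually.of_forall fun _ => zero_le) ((eventually_ge_atTop 4).mono fun L hL => ?_)
  have hL0 : 0 < L := by linarith
  -- With radius `L ^ 2` and layer width `L`, the shell term `M * L ^ 3` is of lower order than `L ^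
  -- 4`.
  refine (mul_le_mul_right (h (L ^ 2) L hL0 (by nlinarith)) _).trans (le_of_eq ?_)
  have h0 : 0 ≤ 1 / (L ^ 2) ^ 2 := by positivity
  rw [mul_add, ← mul_assoc, ← ENNReal.ofReal_mul h0, ← ENNReal.ofReal_mul h0]
  have e1 : 1 / (L ^ 2) ^ 2 * (c * (L ^ 2) ^ 2) = c := by field_simp
  have e2 : 1 / (L ^ 2) ^ 2 * (M * (L ^ 2 * L)) = M / L := by field_simp
  rw [e1, e2]

/-! ### Comparison of a minimizer with its translates -/

/-- A cutoff function equal to `1` near the origin, together with a bound for its Lipschitz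
constant. -/
lemma exists_lipschitz_cutoff : ∃ (φ : Plane → ℝ) (Λ : ℝ), 0 ≤ Λ ∧ ContDiff ℝ 1 φ ∧
    (∀ x y, |φ x - φ y| ≤ Λ * ‖x - y‖) ∧ (∀ x, ‖x‖ ≤ 1 / 4 → φ x = 1) ∧
    tsupport φ ⊆ Metric.closedBall 0 (1 / 3) := by
  -- An outer radius below `1 / 2` places the rescaled closed support inside the open ball of radius
  -- `R / 2`.
  let f : ContDiffBump (0 : Plane) := ⟨1 / 4, 1 / 3, by norm_num, by norm_num⟩
  have hf : ContDiff ℝ 1 f := f.contDiff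
  obtain ⟨Λ, hΛ⟩ := hf.lipschitzWith_of_hasCompactSupport f.hasCompactSupport (by norm_num)
  refine ⟨f, Λ, Λ.2, hf, fun x y => ?_, fun x hx => ?_, f.tsupport_eq.subset⟩
  · have := hΛ.dist_le_mul x y
    rwa [Real.dist_eq, dist_eq_norm] at this
  · exact f.one_of_mem_closedBall (mem_closedBall_zero_iff.2 hx)

/-- Deformations at scale `R`: they agree with the translation by `h` in a ball of radius
proportional to `R` and with the identity far away, and have size proportional to `1 / R`. -/
lemma exists_deformation_at_scale : ∃ Λ : ℝ, 0 ≤ Λ ∧ ∀ (h : Plane) (R : ℝ), 0 < R →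
    2 * (Λ * ‖h‖) ≤ R → ∃ (g : Plane → ℝ) (Φ Ψ : Plane ≃ₜ Plane),
      IsDeformation g h (Λ * ‖h‖ / R) Φ ∧ IsDeformation g (-h) (Λ * ‖h‖ / R) Ψ ∧
      (∀ x, ‖x‖ ≤ R / 4 → g x = 1) ∧ tsupport g ⊆ Metric.ball 0 (R / 2) := by
  obtain ⟨φ, Λ, hΛ, hφ, hlip, hone, hsupp⟩ := exists_lipschitz_cutoff
  refine ⟨Λ, hΛ, fun h R hR hRh => ?_⟩
  set g : Plane → ℝ := fun x => φ (R⁻¹ • x) with hg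
  have hgc : ContDiff ℝ 1 g := hφ.comp (by fun_prop)
  have hε : Λ * ‖h‖ / R ≤ 1 / 2 := by rw [div_le_iff₀ hR]; linarith
  have hglip : ∀ k : Plane, ‖k‖ = ‖h‖ → ∀ x y, ‖(g x - g y) • k‖ ≤ Λ * ‖h‖ / R * ‖x - y‖ := by
    intro k hk x y
    rw [norm_smul, hk, Real.norm_eq_abs]
    have := hlip (R⁻¹ • x) (R⁻¹ • y)
    rw [← smul_sub, norm_smul, Real.norm_of_nonneg (by positivity)] at this
    calc |g x - g y| * ‖h‖ ≤ Λ * (R⁻¹ * ‖x - y‖) * ‖h‖ := by gcongr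
      _ = _ := by rw [div_eq_mul_inv]; ring
  obtain ⟨Φ, hΦ⟩ := exists_homeomorph_add_smul hε (hglip h rfl)
  obtain ⟨Ψ, hΨ⟩ := exists_homeomorph_add_smul hε (hglip (-h) (norm_neg h))
  refine ⟨g, Φ, Ψ, ⟨hgc, by positivity, hε, hglip h rfl, hΦ⟩,
    ⟨hgc, by positivity, hε, hglip (-h) (norm_neg h), hΨ⟩, fun x hx => hone _ ?_, fun x hx => ?_⟩
  · rw [norm_smul, Real.norm_of_nonneg (by positivity), inv_mul_le_iff₀ hR]
    linarith
  · have hx' : R⁻¹ • x ∈ tsupport φ :=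
      tsupport_comp_subset_preimage φ (by fun_prop : Continuous fun x : Plane => R⁻¹ • x) hx
    have := hsupp hx'
    rw [mem_closedBall_zero_iff, norm_smul, Real.norm_of_nonneg (by positivity),
      inv_mul_le_iff₀ hR] at this
    rw [mem_ball_zero_iff]
    linarith

open Filter Topology in
/-- A bounded minimizer on all balls has zero rearrangement gain with each of its translates. -/
lemma IsConvexKernel.lintegral_gain_translate_eq_zero {s p : ℝ} {K : ℝ → Plane → ℝ} (hs₀ : 0 < s)
    (hs₁ : s < 1) (hp : 1 ≤ p) (hK : IsConvexKernel s p K) {W : ℝ → ℝ} (hW : IsDoubleWell W)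
    {u : Plane → ℝ} (hub : ∀ x, |u x| ≤ 1)
    (hmin : ∀ R : ℝ, 0 < R → IsEnergyMinimizer K W u (Metric.ball 0 R)) (h : Plane) (r : ℝ) :
    ∫⁻ z in Metric.ball 0 r, rearrangementGain K u (fun x => u (x - h)) z = 0 := by
  obtain ⟨C, hC, hbound⟩ := hK.exists_deformation_bound
  obtain ⟨Λ, hΛ, hdef⟩ := exists_deformation_at_scale
  have hWc : ContinuousOn W (Icc (-1) 1) := hW.contDiffOn.continuousOn
  have hu : Measurable u := (hmin 1 one_pos).measurable
  have hlim := ENNReal.Tendsto.const_mul (a := ENNReal.ofReal (C * (Λ * ‖h‖) ^ 2))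
    (hK.tendsto_kineticEnergy_div hs₀ hs₁ hp hW hub hmin) (Or.inr ENNReal.ofReal_ne_top)
  rw [mul_zero] at hlim
  refine le_antisymm (ge_of_tendsto hlim ?_) zero_le
  have hbig : ∀ c : ℝ, ∀ᶠ L : ℝ in atTop, c ≤ L ^ 2 := fun c =>
    (tendsto_pow_atTop two_ne_zero).eventually_ge_atTop c
  -- These give `R > 0`, a deformation of size at most `1 / 2`, `g = 1` on the ball of radius `r`
  -- shifted by `-h`, and `r ≤ R`.
  filter_upwards [hbig 1, hbig (2 * (Λ * ‖h‖)), hbig (4 * (r + ‖h‖)), hbig r] with L h1 h2 h3 h4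
  set R : ℝ := L ^ 2 with hR
  have hR0 : 0 < R := by linarith
  obtain ⟨g, Φ, Ψ, hΦ, hΨ, hg1, hgs⟩ := hdef h R hR0 h2
  set B : Set Plane := Metric.ball 0 R with hB
  set S : Set Plane := Metric.ball 0 (R / 2) with hS
  have hSB : S ⊆ B := Metric.ball_subset_ball (by linarith)
  have hgB : ∀ x, x ∉ B → g x = 0 := fun x hx =>
    image_eq_zero_of_notMem_tsupport fun hx' => hx (hSB (hgs hx'))
  have hE := hbound hWc hu hub hΦ hΨ Metric.isOpen_ball.measurableSet
    Metric.isOpen_ball.measurableSet hSB hgs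
  have hm := hmin R hR0
  set v : Plane → ℝ := fun x => u (Φ.symm x) with hv
  have hvm : Measurable v := hu.comp Φ.symm.measurable
  have hvb : ∀ x, |v x| ≤ 1 := fun x => hub _
  have hfix : ∀ {k : Plane} {Θ : Plane ≃ₜ Plane}, IsDeformation g k (Λ * ‖h‖ / R) Θ →
      ∀ x, x ∈ Bᶜ → u (Θ.symm x) = u x := fun {k Θ} hΘ x hx => by
    have : Θ x = x := by rw [hΘ.eq, hgB x hx, zero_smul, add_zero]
    rw [Θ.symm_apply_eq.2 this.symm]
  have hle1 := hm.le_energy (fun x => u (Ψ.symm x)) (hu.comp Ψ.symm.measurable)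
    (Eventually.of_forall (hfix hΨ))
  have hle2 := hm.le_energy _ (hu.min hvm)
    (Eventually.of_forall fun x hx => by rw [hv]; simp only [hfix hΦ x hx, min_self])
  have hle3 := hm.le_energy _ (hu.max hvm)
    (Eventually.of_forall fun x hx => by rw [hv]; simp only [hfix hΦ x hx, max_self])
  have hsub := hK.nonlocalEnergy_min_add_max_add_gain hWc hu hvm hub hvb B
  set η : ℝ≥0∞ := ENNReal.ofReal (C * (Λ * ‖h‖ / R) ^ 2) * kineticEnergy K u S with hη
  set e : ℝ≥0∞ := nonlocalEnergy K W u B with he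
  have hfin : e ≠ ⊤ := hm.energy_lt_top.ne
  -- Minimality against the opposite deformation turns the bound on the sum into a bound on `v`
  -- alone.
  have hv_le : nonlocalEnergy K W v B ≤ e + η := by
    refine (ENNReal.add_le_add_iff_right hfin).1 ?_
    calc nonlocalEnergy K W v B + e ≤ _ := add_le_add_right hle1 _
      _ ≤ 2 * e + η := hE
      _ = e + η + e := by ring
  -- The minimum and maximum of `u` and `v` each cost at least `e`, so the excess of `v` must pay
  -- for the gain.
  have hgain : ∫⁻ z in (Bᶜ ×ˢ Bᶜ)ᶜ, rearrangementGain K u v z ≤ η := by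
    have h2e : e + e ≠ ⊤ := ENNReal.add_ne_top.2 ⟨hfin, hfin⟩
    refine (ENNReal.add_le_add_iff_left h2e).1 ?_
    calc e + e + ∫⁻ z in (Bᶜ ×ˢ Bᶜ)ᶜ, rearrangementGain K u v z ≤ _ :=
          add_le_add_left (add_le_add hle2 hle3) _
      _ = e + nonlocalEnergy K W v B := hsub
      _ ≤ e + (e + η) := by gcongr
      _ = e + e + η := by ring
  have hball : Metric.ball (0 : Plane × Plane) r ⊆ (Bᶜ ×ˢ Bᶜ)ᶜ := by
    intro z hz hz'
    rw [mem_ball_zero_iff] at hz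
    have : R ≤ ‖z.1‖ := by simpa [hB] using hz'.1
    linarith [norm_fst_le z]
  have hloc : ∀ x : Plane, ‖x‖ < r → v x = u (x - h) := by
    intro x hx
    have : Φ (x - h) = x := by
      rw [hΦ.eq, hg1, one_smul, sub_add_cancel]
      linarith [norm_sub_le x h]
    rw [hv]
    simp only [Φ.symm_apply_eq.2 this.symm]
  calc ∫⁻ z in Metric.ball 0 r, rearrangementGain K u (fun x => u (x - h)) z
      = ∫⁻ z in Metric.ball 0 r, rearrangementGain K u v z := by
        refine setLIntegral_congr_fun Metric.isOpen_ball.measurableSet fun z hz => ?_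
        rw [mem_ball_zero_iff] at hz
        simp only [rearrangementGain, hloc z.1 ((norm_fst_le z).trans_lt hz),
          hloc z.2 ((norm_snd_le z).trans_lt hz)]
    _ ≤ ∫⁻ z in (Bᶜ ×ˢ Bᶜ)ᶜ, rearrangementGain K u v z := lintegral_mono_set hball
    _ ≤ η := hgain
    _ = _ := by
        rw [hη, ← mul_assoc, ← ENNReal.ofReal_mul (by positivity)]
        congr 2
        rw [div_pow]
        ring

theorem theorem1 (s p : ℝ) (hs₀ : 0 < s) (hs₁ : s < 1) (hp : 1 ≤ p)
    (F : ℝ → EuclideanSpace ℝ (Fin 2) → ℝ) (hF : IsAdmissibleInteraction 2 s p F)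
    (W : ℝ → ℝ) (hW : IsDoubleWell W)
    (u : EuclideanSpace ℝ (Fin 2) → ℝ) (hu_cont : Continuous u) (hu_bdd : ∀ x, |u x| ≤ 1)
    (hu_min : ∀ R : ℝ, 0 < R → IsEnergyMinimizer F W u (Metric.ball 0 R)) :
    ∃ ω : EuclideanSpace ℝ (Fin 2), ‖ω‖ = 1 ∧
      ∃ u₀ : ℝ → ℝ, ∀ x, u x = u₀ (inner ℝ ω x) := by
  have hK := hF.isConvexKernel_zeroAtOrigin
  refine exists_one_dimensional_of_translates_ordered hu_cont fun h => ?_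
  have := hK.le_or_le_of_gain_eq_zero hu_cont
    (by fun_prop : Continuous fun x : Plane => u (x - -h))
    (hK.lintegral_gain_translate_eq_zero hs₀ hs₁ hp hW hu_bdd
      (fun R hR => (hu_min R hR).zeroAtOrigin) (-h))
  simpa only [sub_neg_eq_add] using this
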